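/- Let $M\in\mathbb N$ and $\mathcal A\subset\{0,\dots,M-1\}$ with $1<|\mathcal A|<M$, and put $\delta=\frac{\log|\mathcal A|}{\log M}\in(0,1)$. For $N\ge 1$ let $\ell^2_N$ be the space of functions $u:\mathbb Z_N\to\mathbb C$ on $\mathbb Z_N=\mathbb Z/N\mathbb Z\simeq\{0,\dots,N-1\}$ with $\|u\|^2=\sum_{j=0}^{N-1}|u(j)|^2$, and let $\mathcal F_N u(j)=\frac1{\sqrt N}\sum_{\ell=0}^{N-1}e^{-2\pi i j\ell/N}u(\ell)$ be the unitary discrete Fourier transform. For $k\in\mathbb N$ and $N=M^k$, let $\mathcal C_k=\big\{\sum_{j=0}^{k-1}a_jM^j : a_0,\dots,a_{k-1}\in\mathcal A\big\}\subset\mathbb Z_N$, let $1_{\mathcal C_k}$ be multiplication by its indicator function, and let $r_k=\|1_{\mathcal C_k}\mathcal F_N 1_{\mathcal C_k}\|_{\ell^2_N\to\ell^2_N}$. Then the limit $$\beta=\beta(M,\mathcal A)=-\lim_{k\to\infty}\frac{\log r_k}{k\log M}$$ exists, is a real number, and satisfies $\beta>\max\big(0,\tfrac12-\delta\big)$. Moreover,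 for this $\beta$ and every $\chi\in C_0^\infty((0,1);[0,1])$, $$\limsup_{k\to\infty,\;N=M^k}\ \max\{|\lambda| : \lambda\in\mathrm{Sp}(B_{N})\}\ \le\ M^{-\beta},$$ where, for $N=M^k$, $k\ge1$, the open quantum baker's map $B_N=B_{N,\chi}:\ell^2_N\to\ell^2_N$ is $$B_N=\sum_{a\in\mathcal A}\mathcal F_N^*\,\Pi_a^*\,\chi_{N/M}\,\mathcal F_{N/M}\,\chi_{N/M}\,\Pi_a .$$ Here $\Pi_a:\ell^2_N\to\ell^2_{N/M}$ is given by $\Pi_a u(j)=u\big(j+a\tfrac NM\big)$ for $0\le j<\tfrac NM$, and $\chi_{N/M}$ is the multiplication operator on $\ell^2_{N/M}$ by the function $j\mapsto\chi\big(\tfrac{jM}{N}\big)$. -/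

import Mathlib

open Filter Topology
open scoped ENNReal ContDiff Matrix

noncomputable section

namespace OpenBaker

/-- The unitary discrete Fourier transform `𝓕_N` on `ℓ²(ℤ_N)`, `ℤ_N ≃ {0, …, N - 1}`, as a matrix:
`(𝓕_N u)(j) = N^{-1/2} ∑_ℓ exp(-2πi jℓ / N) u(ℓ)`. -/
def fourier (N : ℕ) : Matrix (Fin N) (Fin N) ℂ :=
  fun j l => (1 / (Real.sqrt (N : ℝ) : ℂ)) *
    Complex.exp (-(2 * (Real.pi : ℂ) * Complex.I * ((j : ℕ) : ℂ) * ((l : ℕ) : ℂ) / (N : ℂ)))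

/-- Multiplication by the indicator function of a set `X ⊆ ℤ_N`. -/
def indicatorOp {N : ℕ} (X : Set (Fin N)) : Matrix (Fin N) (Fin N) ℂ :=
  Matrix.diagonal (X.indicator (fun _ => (1 : ℂ)))

/-- The operator norm `ℓ²_N → ℓ²_N` of a matrix. -/
def opNorm {N : ℕ} (T : Matrix (Fin N) (Fin N) ℂ) : ℝ :=
  ‖Matrix.toEuclideanCLM (n := Fin N) (𝕜 := ℂ) T‖

/-- The `k`-th order Cantor set `{∑_{j<k} a_j M^j : a_0, …, a_{k-1} ∈ A}` in `ℤ_N`, `N = M^k`. -/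
def cantorSet (M : ℕ) (A : Finset (Fin M)) (k : ℕ) : Set (Fin (M ^ k)) :=
  {x | ∃ a : Fin k → Fin M, (∀ j, a j ∈ A) ∧
    (x : ℕ) = ∑ j : Fin k, (a j : ℕ) * M ^ (j : ℕ)}

/-- `r_k`, the norm on `ℓ²_N`, `N = M^k`, of `1_{C_k} 𝓕_N 1_{C_k}`. -/
def cantorNorm (M : ℕ) (A : Finset (Fin M)) (k : ℕ) : ℝ :=
  opNorm (indicatorOp (cantorSet M A k) * fourier (M ^ k) * indicatorOp (cantorSet M A k))

/-- The dimension `δ = log |A| / log M`. -/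
def dimension (M : ℕ) (A : Finset (Fin M)) : ℝ :=
  Real.log (A.card : ℝ) / Real.log (M : ℝ)

/-- Cutoff functions: `χ ∈ C_0^∞((0,1); [0,1])`, extended by zero to the real line. -/
structure IsCutoff (χ : ℝ → ℝ) : Prop where
  smooth : ContDiff ℝ ∞ χ
  compactSupport : HasCompactSupport χ
  support_subset : tsupport χ ⊆ Set.Ioo 0 1
  mem_Icc : ∀ x, χ x ∈ Set.Icc (0 : ℝ) 1

/-- The multiplication operator `χ_N` on `ℓ²_N` by `χ_N(j) = χ(j / N)`. -/
def cutoffOp (χ : ℝ → ℝ) (N : ℕ) : Matrix (Fin N) (Fin N) ℂ :=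
  Matrix.diagonal (fun j => (χ (((j : ℕ) : ℝ) / (N : ℝ)) : ℂ))

/-- The projection `Π_a : ℓ²_N → ℓ²_{N/M}`, `(Π_a u)(j) = u(j + a N/M)` for `0 ≤ j < N/M`. -/
def proj (M N : ℕ) (a : Fin M) : Matrix (Fin (N / M)) (Fin N) ℂ :=
  fun j l => if (l : ℕ) = (j : ℕ) + (a : ℕ) * (N / M) then 1 else 0

/-- The open quantum baker's map
`B_N = ∑_{a ∈ A} 𝓕_N^* Π_a^* χ_{N/M} 𝓕_{N/M} χ_{N/M} Π_a`
(meaningful when `M` divides `N`). -/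
def bakerMap (M : ℕ) (A : Finset (Fin M)) (χ : ℝ → ℝ) (N : ℕ) : Matrix (Fin N) (Fin N) ℂ :=
  ∑ a ∈ A, (fourier N)ᴴ * (proj M N a)ᴴ *
    (cutoffOp χ (N / M) * fourier (N / M) * cutoffOp χ (N / M)) * proj M N a

end OpenBaker

end

/-! Write `N = M^k`. Cutting the digit string of `x` into high digits `p` and low digits `q`, and
that of `y` the opposite way into `r` and `s`, factors the Fourier kernel as in the fast Fourier
transform: a transform of size `M^k₂` in `p`, a unimodular twist, a transform of size `M^k₁` in `q`.
Hence `r_k` is submultiplicative (`cantorNorm_add_le`). By Fekete's lemma `log r_k / k` converges to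
its infimum, which is finite because a single matrix entry gives `r_k ≥ N^(-1/2)`. Since the limit
is an infimum, one good `k` suffices for each strict bound on `β`.

For `β > 0`: if `r_k = 1`, some nonzero `u` on `C_k` has its transform supported on `C_k`. That
transform vanishes on the block of `M^(k-1)` consecutive points whose leading digit is not in `A`.
For large `k` this block has at least `|C_k|` points, and a Vandermonde determinant forces `u = 0`
(`cantorNorm_lt_one`). For `β > 1/2 - δ`: `|A|²/M` is the Hilbert–Schmidt norm at `k = 2`, and
equality would force rank one, which a two by two minor excludes (`cantorNorm_two_lt`).

For the spectrum, repeated summation by parts shows that the kernel of `B_N` is negligible off the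
graph of the expanding map (`exists_norm_bakerMap_apply_le`). So `B_N^(k-m)` only sees its argument
near `C_k`, at scale `M^m`. Conjugation by the Fourier transform transposes `B_N`, so the range of
`B_N^(k-m)` is localized near `C_k` in frequency as well. For an eigenvalue `z` this yields
`|z|^(2(k-m)) ≤ 49 M^(2m) r_k |z|^(k-m)` plus a negligible term (`exists_spectrum_bakerMap_bound`).
Taking `m` to be a small fraction of `k` gives the limsup bound. -/

namespace OpenBaker

open scoped Matrix.Norms.L2Operator

set_option linter.unusedSectionVars false

/-! ### Operator norms of complex matrices. -/

section Norms

variable {m n : Type*} [Fintype m] [Fintype n] [DecidableEq m] [DecidableEq n]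

lemma sum_norm_sq_mulVec_le (T : Matrix m n ℂ) (u : n → ℂ) :
    ∑ i, ‖(T *ᵥ u) i‖ ^ 2 ≤ ‖T‖ ^ 2 * ∑ j, ‖u j‖ ^ 2 := by
  have h := T.l2_opNorm_mulVec (WithLp.toLp 2 u)
  have h2 := pow_le_pow_left₀ (norm_nonneg _) h 2
  rw [mul_pow, EuclideanSpace.norm_sq_eq, EuclideanSpace.norm_sq_eq] at h2
  simpa using h2

lemma norm_le_of_sum_norm_sq_mulVec_le (T : Matrix m n ℂ) {c : ℝ} (hc : 0 ≤ c)
    (h : ∀ u : n → ℂ, ∑ i, ‖(T *ᵥ u) i‖ ^ 2 ≤ c ^ 2 * ∑ j, ‖u j‖ ^ 2) : ‖T‖ ≤ c := by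
  rw [Matrix.l2_opNorm_def]
  refine ContinuousLinearMap.opNorm_le_bound _ hc fun u => ?_
  refine (sq_le_sq₀ (norm_nonneg _) (by positivity)).1 ?_
  rw [mul_pow, EuclideanSpace.norm_sq_eq, EuclideanSpace.norm_sq_eq]
  simpa using h u.ofLp

lemma norm_le_one_of_conjTranspose_mul_self (T : Matrix m n ℂ) (h : ‖Tᴴ * T‖ ≤ 1) : ‖T‖ ≤ 1 := by
  rw [Matrix.l2_opNorm_conjTranspose_mul_self] at h
  nlinarith [norm_nonneg T]

lemma norm_le_one_of_mul_conjTranspose_self (T : Matrix m n ℂ) (h : ‖T * Tᴴ‖ ≤ 1) : ‖T‖ ≤ 1 := by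
  rw [← Matrix.l2_opNorm_conjTranspose]
  exact norm_le_one_of_conjTranspose_mul_self _ (by simpa using h)

lemma norm_diagonal_le_one {v : n → ℂ} (h : ∀ i, ‖v i‖ ≤ 1) :
    ‖(Matrix.diagonal v : Matrix n n ℂ)‖ ≤ 1 := by
  rw [Matrix.l2_opNorm_diagonal]
  exact (pi_norm_le_iff_of_nonneg zero_le_one).2 h

lemma norm_one_matrix_le : ‖(1 : Matrix n n ℂ)‖ ≤ 1 := by
  rw [← Matrix.diagonal_one]
  exact norm_diagonal_le_one fun i => by simp

/-- Cauchy–Schwarz row by row. The loss of a factor `card n` is harmless later, where the entries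
are smaller than any chosen power of it. -/
lemma norm_le_card_mul_of_forall_norm_le (T : Matrix n n ℂ) {c : ℝ} (hc : 0 ≤ c)
    (h : ∀ i j, ‖T i j‖ ≤ c) : ‖T‖ ≤ Fintype.card n * c := by
  refine norm_le_of_sum_norm_sq_mulVec_le T (by positivity) fun u => ?_
  have key : ∀ i, ‖(T *ᵥ u) i‖ ^ 2 ≤ Fintype.card n * c ^ 2 * ∑ j, ‖u j‖ ^ 2 := fun i => by
    have h1 : ‖(T *ᵥ u) i‖ ≤ c * ∑ j, ‖u j‖ := by
      rw [Matrix.mulVec, dotProduct, Finset.mul_sum]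
      refine (norm_sum_le _ _).trans (Finset.sum_le_sum fun j _ => ?_)
      rw [norm_mul]
      gcongr
      exact h i j
    have h2 : (∑ j, ‖u j‖) ^ 2 ≤ Fintype.card n * ∑ j, ‖u j‖ ^ 2 := by
      simpa using sq_sum_le_card_mul_sum_sq (s := Finset.univ) (f := fun j => ‖u j‖)
    calc ‖(T *ᵥ u) i‖ ^ 2 ≤ (c * ∑ j, ‖u j‖) ^ 2 := by gcongr
      _ = c ^ 2 * (∑ j, ‖u j‖) ^ 2 := by ring
      _ ≤ c ^ 2 * (Fintype.card n * ∑ j, ‖u j‖ ^ 2) := by gcongr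
      _ = _ := by ring
  calc _ ≤ ∑ _i : n, Fintype.card n * c ^ 2 * ∑ j, ‖u j‖ ^ 2 := Finset.sum_le_sum fun i _ => key i
    _ = _ := by rw [Finset.sum_const, nsmul_eq_mul, Finset.card_univ]; ring

lemma norm_apply_le (T : Matrix m n ℂ) (i : m) (j : n) : ‖T i j‖ ≤ ‖T‖ := by
  have h := sum_norm_sq_mulVec_le T (Pi.single j 1)
  have h1 : ∑ l, ‖(Pi.single j (1 : ℂ) : n → ℂ) l‖ ^ 2 = 1 := by
    rw [Finset.sum_eq_single j] <;> simp +contextual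
  rw [h1, mul_one] at h
  have h2 : ‖(T *ᵥ (Pi.single j (1 : ℂ))) i‖ ^ 2 ≤ ∑ i, ‖(T *ᵥ (Pi.single j (1 : ℂ))) i‖ ^ 2 :=
    Finset.single_le_sum (f := fun i => ‖(T *ᵥ (Pi.single j (1 : ℂ))) i‖ ^ 2)
      (fun _ _ => by positivity) (Finset.mem_univ i)
  have h3 := (sq_le_sq₀ (norm_nonneg _) (norm_nonneg _)).1 (h2.trans h)
  simpa using h3

/-- The matrix `Tᵀᴴ` is the entrywise conjugate of `T`, so it acts on `u` as `T` acts on `star u`,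
up to conjugation. -/
lemma norm_transpose_le_of_forall {c : ℝ} (T : Matrix n n ℂ) (h : ‖T‖ ≤ c) : ‖Tᵀ‖ ≤ c := by
  have hc := (norm_nonneg T).trans h
  rw [← Matrix.l2_opNorm_conjTranspose]
  refine norm_le_of_sum_norm_sq_mulVec_le _ hc fun u => ?_
  have h1 := sum_norm_sq_mulVec_le T (star u)
  have h2 : ∀ i, ‖(Tᵀᴴ *ᵥ u) i‖ = ‖(T *ᵥ star u) i‖ := fun i => by
    rw [← norm_star]
    congr 1
    simp [Matrix.mulVec, dotProduct, mul_comm]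
  simp only [h2]
  refine h1.trans ?_
  simp only [Pi.star_apply, norm_star]
  gcongr

end Norms

/-! ### Additive characters, the discrete Fourier transform and coordinate projections. -/

/-- The character `exp(-2πi n / N)`. -/
noncomputable def psi (N : ℕ) (n : ℤ) : ℂ :=
  Complex.exp (-(2 * (Real.pi : ℂ) * Complex.I * (n : ℂ) / (N : ℂ)))

lemma psi_add (N : ℕ) (a b : ℤ) : psi N (a + b) = psi N a * psi N b := by
  rw [psi, psi, psi, ← Complex.exp_add]
  congr 1
  push_cast
  ring

lemma psi_zero (N : ℕ) : psi N 0 = 1 := by simp [psi]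

lemma psi_eq_exp (N : ℕ) (n : ℤ) :
    psi N n = Complex.exp (Complex.I * ((-(2 * Real.pi * n / N) : ℝ) : ℂ)) := by
  rw [psi]; congr 1; push_cast; ring

lemma norm_psi (N : ℕ) (n : ℤ) : ‖psi N n‖ = 1 := by
  rw [psi_eq_exp, mul_comm, Complex.norm_exp_ofReal_mul_I]

lemma psi_ne_zero (N : ℕ) (n : ℤ) : psi N n ≠ 0 := Complex.exp_ne_zero _

lemma psi_neg (N : ℕ) (n : ℤ) : psi N (-n) = star (psi N n) := by
  rw [psi_eq_exp, psi_eq_exp, Complex.star_def, ← Complex.exp_conj]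
  congr 1
  simp only [map_mul, Complex.conj_I, Complex.conj_ofReal]
  push_cast
  ring

lemma star_psi_mul_self (N : ℕ) (n : ℤ) : star (psi N n) * psi N n = 1 := by
  rw [← psi_neg, ← psi_add]; simp [psi_zero]

lemma psi_pow (N : ℕ) (a : ℤ) (n : ℕ) : psi N a ^ n = psi N (a * n) := by
  rw [psi, psi, ← Complex.exp_nat_mul]
  congr 1
  push_cast
  ring

lemma psi_mul_left {N K : ℕ} (hK : K ≠ 0) (a : ℤ) : psi (N * K) (a * K) = psi N a := by
  have : (K : ℂ) ≠ 0 := by exact_mod_cast hK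
  rw [psi, psi]
  congr 1
  push_cast
  -- For `N = 0` both exponents are quotients by zero, hence zero.
  by_cases hN : (N : ℂ) = 0
  · simp [hN]
  · field_simp

lemma psi_eq_one_iff {N : ℕ} (hN : N ≠ 0) (a : ℤ) : psi N a = 1 ↔ (N : ℤ) ∣ a := by
  have hN' : (N : ℂ) ≠ 0 := by exact_mod_cast hN
  have hpi : (Real.pi : ℂ) ≠ 0 := by exact_mod_cast Real.pi_ne_zero
  rw [psi, Complex.exp_eq_one_iff]
  constructor
  · rintro ⟨n, hn⟩
    refine ⟨-n, ?_⟩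
    have : (a : ℂ) = N * (-n : ℤ) := by
      field_simp at hn
      push_cast
      have h2 : (2 * Real.pi * Complex.I : ℂ) ≠ 0 := by simp [hpi]
      linear_combination -hn
    exact_mod_cast this
  · rintro ⟨n, rfl⟩
    refine ⟨-n, ?_⟩
    push_cast
    field_simp

lemma psi_mul_self {N : ℕ} (hN : N ≠ 0) (a : ℤ) : psi N (N * a) = 1 :=
  (psi_eq_one_iff hN _).2 ⟨a, rfl⟩

lemma fourier_apply (N : ℕ) (j l : Fin N) :
    fourier N j l = (1 / (Real.sqrt N : ℂ)) * psi N ((j : ℕ) * (l : ℕ) : ℤ) := by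
  rw [fourier, psi]
  congr 3
  push_cast
  ring

lemma norm_fourier_apply (N : ℕ) (j l : Fin N) : ‖fourier N j l‖ = 1 / Real.sqrt N := by
  rw [fourier_apply, norm_mul, norm_psi, mul_one]
  simp [abs_of_nonneg]

lemma fourier_transpose (N : ℕ) : (fourier N)ᵀ = fourier N := by
  ext j l
  rw [Matrix.transpose_apply, fourier_apply, fourier_apply, mul_comm ((l : ℕ) : ℤ)]

lemma sum_psi {N : ℕ} (hN : N ≠ 0) (a : ℤ) (ha : ¬ (N : ℤ) ∣ a) :
    ∑ l : Fin N, psi N (a * (l : ℕ)) = 0 := by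
  simp only [← psi_pow]
  rw [Fin.sum_univ_eq_sum_range (fun i => psi N a ^ i)]
  have h1 : psi N a ≠ 1 := fun h => ha ((psi_eq_one_iff hN a).1 h)
  rw [geom_sum_eq h1, psi_pow, mul_comm, psi_mul_self hN]
  simp

lemma fourier_conjTranspose_mul_self (N : ℕ) : (fourier N)ᴴ * fourier N = 1 := by
  ext i j
  have hN : N ≠ 0 := by rintro rfl; exact i.elim0
  have hs : (Real.sqrt N : ℂ) * Real.sqrt N = N := by
    rw [← Complex.ofReal_mul, Real.mul_self_sqrt (Nat.cast_nonneg _)]; simp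
  have hN' : (N : ℂ) ≠ 0 := by exact_mod_cast hN
  have hs0 : (Real.sqrt N : ℂ) ≠ 0 := by rintro h; rw [h] at hs; simp [hN'.symm] at hs
  have h1 : ∀ l : Fin N, star (fourier N l i) * fourier N l j
      = (1 / N) * psi N (((j : ℕ) - (i : ℕ) : ℤ) * (l : ℕ)) := fun l => by
    rw [fourier_apply, fourier_apply, star_mul', ← psi_neg,
      show (((j : ℕ) - (i : ℕ) : ℤ) * (l : ℕ)) = -((l : ℕ) * (i : ℕ) : ℤ) + (l : ℕ) * (j : ℕ) by ring,
      psi_add]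
    have : star (1 / (Real.sqrt N : ℂ)) = 1 / (Real.sqrt N : ℂ) := by
      simp
    rw [this, ← hs]
    field_simp
  rw [Matrix.mul_apply]
  simp only [Matrix.conjTranspose_apply, h1]
  rw [← Finset.mul_sum]
  by_cases hij : i = j
  · subst hij
    simp [psi_zero, hN']
  · rw [sum_psi hN, Matrix.one_apply_ne hij, mul_zero]
    intro hd
    apply hij
    have := Int.eq_zero_of_abs_lt_dvd hd (by rw [abs_lt]; constructor <;> omega)
    ext
    omega

lemma fourier_mul_conjTranspose (N : ℕ) : fourier N * (fourier N)ᴴ = 1 :=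
  mul_eq_one_comm.1 (fourier_conjTranspose_mul_self N)

lemma norm_fourier_le (N : ℕ) : ‖fourier N‖ ≤ 1 :=
  norm_le_one_of_conjTranspose_mul_self _ (by
    rw [fourier_conjTranspose_mul_self]; exact norm_one_matrix_le)

lemma norm_indicatorOp_le {N : ℕ} (X : Set (Fin N)) : ‖indicatorOp X‖ ≤ 1 := by
  refine norm_diagonal_le_one fun i => ?_
  by_cases h : i ∈ X <;> simp [h]

lemma indicatorOp_add_compl {N : ℕ} (X : Set (Fin N)) : indicatorOp X + indicatorOp Xᶜ = 1 := by
  rw [indicatorOp, indicatorOp, Matrix.diagonal_add, ← Matrix.diagonal_one]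
  congr 1
  ext i
  by_cases h : i ∈ X <;> simp [h]

lemma indicatorOp_transpose {N : ℕ} (X : Set (Fin N)) : (indicatorOp X)ᵀ = indicatorOp X := by
  rw [indicatorOp, Matrix.diagonal_transpose]

lemma indicatorOp_conjTranspose {N : ℕ} (X : Set (Fin N)) : (indicatorOp X)ᴴ = indicatorOp X := by
  rw [indicatorOp, Matrix.diagonal_conjTranspose]
  congr 1
  ext i
  by_cases h : i ∈ X <;> simp [h]

open Classical in
lemma indicatorOp_mul_mul_apply {N : ℕ} (X Y : Set (Fin N)) (T : Matrix (Fin N) (Fin N) ℂ)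
    (i j : Fin N) : (indicatorOp X * T * indicatorOp Y) i j
      = if i ∈ X ∧ j ∈ Y then T i j else 0 := by
  rw [indicatorOp, indicatorOp, Matrix.mul_diagonal, Matrix.diagonal_mul]
  by_cases h : i ∈ X <;> by_cases h' : j ∈ Y <;> simp [h, h']

end OpenBaker

/-! ### Digit combinatorics of the Cantor sets. -/

namespace OpenBaker

open scoped Matrix.Norms.L2Operator

/-- The Cantor set of order `k` as a finite set of natural numbers. -/
def cantorNat (M : ℕ) (A : Finset (Fin M)) : ℕ → Finset ℕ
  | 0 => {0}
  | k + 1 => (A ×ˢ cantorNat M A k).image fun p => (p.1 : ℕ) * M ^ k + p.2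

section Cantor

variable {M : ℕ} {A : Finset (Fin M)}

lemma mem_cantorNat_succ {k x : ℕ} :
    x ∈ cantorNat M A (k + 1) ↔ ∃ a ∈ A, ∃ c ∈ cantorNat M A k, x = (a : ℕ) * M ^ k + c := by
  simp only [cantorNat, Finset.mem_image, Finset.mem_product, Prod.exists]
  constructor
  · rintro ⟨a, c, ⟨ha, hc⟩, rfl⟩; exact ⟨a, ha, c, hc, rfl⟩
  · rintro ⟨a, ha, c, hc, rfl⟩; exact ⟨a, c, ⟨ha, hc⟩, rfl⟩

lemma cantorNat_lt {k x : ℕ} (hx : x ∈ cantorNat M A k) : x < M ^ k := by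
  induction k generalizing x with
  | zero => simp_all [cantorNat]
  | succ k ih =>
    obtain ⟨a, -, c, hc, rfl⟩ := mem_cantorNat_succ.1 hx
    have := ih hc
    have h2 : ((a : ℕ) + 1) * M ^ k ≤ M * M ^ k := Nat.mul_le_mul_right _ a.2
    rw [pow_succ]
    nlinarith

lemma cantorNat_nonempty (hA : A.Nonempty) (k : ℕ) : (cantorNat M A k).Nonempty := by
  induction k with
  | zero => exact ⟨0, by simp [cantorNat]⟩
  | succ k ih =>
    obtain ⟨c, hc⟩ := ih
    obtain ⟨a, ha⟩ := hA
    exact ⟨_, mem_cantorNat_succ.2 ⟨a, ha, c, hc, rfl⟩⟩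

lemma mem_cantorSet_iff {k : ℕ} (x : Fin (M ^ k)) :
    x ∈ cantorSet M A k ↔ (x : ℕ) ∈ cantorNat M A k := by
  rw [cantorSet, Set.mem_ofPred_eq]
  generalize (x : ℕ) = y
  clear x
  induction k generalizing y with
  | zero => simp [cantorNat]
  | succ k ih =>
    rw [mem_cantorNat_succ]
    constructor
    · rintro ⟨a, ha, rfl⟩
      -- The recursion adds a leading digit, which is the last index of the digit string.
      refine ⟨a (Fin.last k), ha _, ∑ j : Fin k, (a j.castSucc : ℕ) * M ^ (j : ℕ), ?_, ?_⟩
      · exact (ih _).1 ⟨fun j => a j.castSucc, fun j => ha _, rfl⟩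
      · rw [Fin.sum_univ_castSucc, add_comm]
        simp
    · rintro ⟨d, hd, c, hc, rfl⟩
      obtain ⟨a, ha, rfl⟩ := (ih _).2 hc
      refine ⟨Fin.snoc a d, fun j => ?_, ?_⟩
      · refine Fin.lastCases ?_ (fun j => ?_) j
        · simpa using hd
        · simpa using ha j
      · rw [Fin.sum_univ_castSucc, add_comm]
        simp

/-- The high `k₂` digits form `p` and the low `k₁` digits form `q`. This cut underlies
submultiplicativity. -/
lemma mem_cantorNat_add {k₁ k₂ x : ℕ} : x ∈ cantorNat M A (k₁ + k₂) ↔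
    ∃ p ∈ cantorNat M A k₂, ∃ q ∈ cantorNat M A k₁, x = M ^ k₁ * p + q := by
  induction k₂ generalizing x with
  | zero => simp [cantorNat]
  | succ k ih =>
    rw [← add_assoc, mem_cantorNat_succ]
    constructor
    · rintro ⟨a, ha, c, hc, rfl⟩
      obtain ⟨p, hp, q, hq, rfl⟩ := ih.1 hc
      exact ⟨_, mem_cantorNat_succ.2 ⟨a, ha, p, hp, rfl⟩, q, hq, by rw [pow_add]; ring⟩
    · rintro ⟨p, hp, q, hq, rfl⟩
      obtain ⟨a, ha, p', hp', rfl⟩ := mem_cantorNat_succ.1 hp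
      exact ⟨a, ha, _, ih.2 ⟨p', hp', q, hq, rfl⟩, by rw [pow_add]; ring⟩

lemma mul_add_injOn_cantorNat (k₁ k₂ : ℕ) : Set.InjOn (fun p : ℕ × ℕ => M ^ k₁ * p.1 + p.2)
    (cantorNat M A k₂ ×ˢ cantorNat M A k₁ : Finset (ℕ × ℕ)) := by
  rintro ⟨p, q⟩ h ⟨p', q'⟩ h' he
  simp only [Finset.coe_product, Set.mem_prod, Finset.mem_coe] at h h' he
  have h1 := cantorNat_lt h.2
  have h2 := cantorNat_lt h'.2
  have hM : 0 < M ^ k₁ := by omega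
  have e1 := congrArg (· / M ^ k₁) he
  have e2 := congrArg (· % M ^ k₁) he
  simp only [Nat.mul_add_div hM, Nat.mul_add_mod, Nat.div_eq_of_lt h1, Nat.div_eq_of_lt h2,
    Nat.mod_eq_of_lt h1, Nat.mod_eq_of_lt h2] at e1 e2
  ext <;> simp_all

lemma cantorNat_add (k₁ k₂ : ℕ) : cantorNat M A (k₁ + k₂) =
    (cantorNat M A k₂ ×ˢ cantorNat M A k₁).image fun p => M ^ k₁ * p.1 + p.2 := by
  ext x
  rw [mem_cantorNat_add]
  simp only [Finset.mem_image, Finset.mem_product, Prod.exists]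
  constructor
  · rintro ⟨p, hp, q, hq, rfl⟩; exact ⟨p, q, ⟨hp, hq⟩, rfl⟩
  · rintro ⟨p, q, ⟨hp, hq⟩, rfl⟩; exact ⟨p, hp, q, hq, rfl⟩

lemma sum_cantorNat_add {E : Type*} [AddCommMonoid E] (k₁ k₂ : ℕ) (f : ℕ → E) :
    ∑ x ∈ cantorNat M A (k₁ + k₂), f x
      = ∑ p ∈ cantorNat M A k₂, ∑ q ∈ cantorNat M A k₁, f (M ^ k₁ * p + q) := by
  rw [cantorNat_add, Finset.sum_image (mul_add_injOn_cantorNat k₁ k₂), Finset.sum_product]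

lemma card_cantorNat (k : ℕ) : (cantorNat M A k).card = A.card ^ k := by
  induction k with
  | zero => simp [cantorNat]
  | succ k ih =>
    have h1 : (cantorNat M A 1).card = A.card := by
      have : cantorNat M A 1 = A.map Fin.valEmbedding := by
        ext x
        rw [mem_cantorNat_succ]
        simp only [cantorNat, Finset.mem_singleton, Finset.mem_map]
        constructor
        · rintro ⟨a, ha, c, rfl, rfl⟩; exact ⟨a, ha, by simp⟩
        · rintro ⟨a, ha, rfl⟩; exact ⟨a, ha, 0, rfl, by simp⟩
      rw [this, Finset.card_map]
    rw [cantorNat_add, Finset.card_image_of_injOn (mul_add_injOn_cantorNat k 1),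
      Finset.card_product, ih, h1, pow_succ, mul_comm]

lemma sum_fin_ite_mem {E : Type*} [AddCommMonoid E] {N : ℕ} (S : Finset ℕ) (hS : ∀ x ∈ S, x < N)
    (f : ℕ → E) : ∑ i : Fin N, (if (i : ℕ) ∈ S then f i else 0) = ∑ x ∈ S, f x := by
  rw [Fin.sum_univ_eq_sum_range (fun i => if i ∈ S then f i else 0), ← Finset.sum_filter]
  congr 1
  ext x
  simp only [Finset.mem_filter, Finset.mem_range]
  exact ⟨fun h => h.2, fun h => ⟨hS x h, h⟩⟩

/-! ### The norms `r_k` as bounds for exponential sums over Cantor sets. -/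

/-- `1_{C_k} 𝓕 1_{C_k}` as a sum over the Cantor set. -/
lemma cantor_mulVec (k : ℕ) (u : ℕ → ℂ) (y : Fin (M ^ k)) :
    ((indicatorOp (cantorSet M A k) * fourier (M ^ k) * indicatorOp (cantorSet M A k)) *ᵥ
        fun i : Fin (M ^ k) => u i) y
      = if (y : ℕ) ∈ cantorNat M A k then (1 / (Real.sqrt (M ^ k : ℕ) : ℂ)) *
          ∑ x ∈ cantorNat M A k, psi (M ^ k) ((y : ℕ) * x) * u x else 0 := by
  rw [Matrix.mulVec, dotProduct]
  simp only [indicatorOp_mul_mul_apply, mem_cantorSet_iff]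
  by_cases hy : (y : ℕ) ∈ cantorNat M A k
  · simp only [hy, true_and, if_true]
    rw [← sum_fin_ite_mem (cantorNat M A k) (fun _ => cantorNat_lt), Finset.mul_sum]
    refine Finset.sum_congr rfl fun i _ => ?_
    rw [fourier_apply]
    split_ifs
    · ring
    · simp
  · simp [hy]

lemma sum_norm_sq_cantor_mulVec (hM : 0 < M) (k : ℕ) (u : ℕ → ℂ) :
    (M ^ k : ℝ) * ∑ y, ‖((indicatorOp (cantorSet M A k) * fourier (M ^ k) *
        indicatorOp (cantorSet M A k)) *ᵥ fun i : Fin (M ^ k) => u i) y‖ ^ 2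
      = ∑ y ∈ cantorNat M A k, ‖∑ x ∈ cantorNat M A k, psi (M ^ k) (y * x) * u x‖ ^ 2 := by
  rw [← sum_fin_ite_mem (cantorNat M A k) (fun _ => cantorNat_lt), Finset.mul_sum]
  refine Finset.sum_congr rfl fun y _ => ?_
  rw [cantor_mulVec]
  split_ifs
  · rw [norm_mul, mul_pow, norm_div, norm_one, Complex.norm_real, Real.norm_eq_abs, div_pow,
      sq_abs, Real.sq_sqrt (by positivity)]
    push_cast
    field_simp
  · simp

lemma cantorNorm_eq (M : ℕ) (A : Finset (Fin M)) (k : ℕ) : cantorNorm M A k =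
    ‖indicatorOp (cantorSet M A k) * fourier (M ^ k) * indicatorOp (cantorSet M A k)‖ := rfl

lemma cantorNorm_nonneg (M : ℕ) (A : Finset (Fin M)) (k : ℕ) : 0 ≤ cantorNorm M A k :=
  norm_nonneg _

/-- Test vectors live on `ℕ`, so slices such as `p ↦ u (M ^ k₁ * p + q)` are again admissible and
the estimate can be applied at each scale. -/
lemma sum_norm_sq_cantor_le (hM : 0 < M) (k : ℕ) (u : ℕ → ℂ) :
    ∑ y ∈ cantorNat M A k, ‖∑ x ∈ cantorNat M A k, psi (M ^ k) (y * x) * u x‖ ^ 2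
      ≤ cantorNorm M A k ^ 2 * M ^ k * ∑ x ∈ cantorNat M A k, ‖u x‖ ^ 2 := by
  have h := sum_norm_sq_mulVec_le (indicatorOp (cantorSet M A k) * fourier (M ^ k) *
    indicatorOp (cantorSet M A k)) fun i : Fin (M ^ k) =>
      (fun x => if x ∈ cantorNat M A k then u x else 0) (i : ℕ)
  have h2 := mul_le_mul_of_nonneg_left h (by positivity : (0 : ℝ) ≤ M ^ k)
  rw [sum_norm_sq_cantor_mulVec hM k fun x => if x ∈ cantorNat M A k then u x else 0] at h2
  have e1 : ∀ y : ℕ, ∑ x ∈ cantorNat M A k, psi (M ^ k) (y * x) * u x =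
      ∑ x ∈ cantorNat M A k, psi (M ^ k) (y * x) * (if x ∈ cantorNat M A k then u x else 0) :=
    fun y => Finset.sum_congr rfl fun x hx => by rw [if_pos hx]
  simp only [e1]
  refine h2.trans (le_of_eq ?_)
  rw [cantorNorm_eq, ← sum_fin_ite_mem (cantorNat M A k) (fun _ => cantorNat_lt)]
  have e2 : ∀ i : Fin (M ^ k), ‖(if (i : ℕ) ∈ cantorNat M A k then u i else 0)‖ ^ 2
      = if (i : ℕ) ∈ cantorNat M A k then ‖u i‖ ^ 2 else 0 := fun i => by split_ifs <;> simp
  simp only [e2]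
  ring

/-- Restriction of a vector to the Cantor set, extended by zero to `ℕ`. -/
lemma cantor_mulVec_eq_restrict (k : ℕ) (v : Fin (M ^ k) → ℂ) :
    (indicatorOp (cantorSet M A k) * fourier (M ^ k) * indicatorOp (cantorSet M A k)) *ᵥ v =
    (indicatorOp (cantorSet M A k) * fourier (M ^ k) * indicatorOp (cantorSet M A k)) *ᵥ
      fun i : Fin (M ^ k) => (fun x => if h : x < M ^ k then v ⟨x, h⟩ else 0) (i : ℕ) := by
  congr 1
  ext i
  simp

lemma sum_cantorNat_dite_le (k : ℕ) (v : Fin (M ^ k) → ℂ) :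
    ∑ x ∈ cantorNat M A k, ‖(if h : x < M ^ k then v ⟨x, h⟩ else 0)‖ ^ 2 ≤ ∑ i, ‖v i‖ ^ 2 := by
  rw [← sum_fin_ite_mem (cantorNat M A k) (fun _ => cantorNat_lt)]
  refine Finset.sum_le_sum fun i _ => ?_
  split_ifs <;> simp_all

lemma cantorNorm_le (hM : 0 < M) {k : ℕ} {c : ℝ} (hc : 0 ≤ c)
    (h : ∀ u : ℕ → ℂ, ∑ y ∈ cantorNat M A k,
      ‖∑ x ∈ cantorNat M A k, psi (M ^ k) (y * x) * u x‖ ^ 2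
        ≤ c ^ 2 * M ^ k * ∑ x ∈ cantorNat M A k, ‖u x‖ ^ 2) : cantorNorm M A k ≤ c := by
  rw [cantorNorm_eq]
  refine norm_le_of_sum_norm_sq_mulVec_le _ hc fun v => ?_
  have hp : (0 : ℝ) < M ^ k := by positivity
  refine le_of_mul_le_mul_left ?_ hp
  rw [cantor_mulVec_eq_restrict,
    sum_norm_sq_cantor_mulVec hM k fun x => if h : x < M ^ k then v ⟨x, h⟩ else 0]
  refine (h _).trans ?_
  rw [← mul_assoc, mul_comm (c ^ 2)]
  gcongr
  exact sum_cantorNat_dite_le k v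

/-- In finite dimension the unit sphere is compact and the norm is attained, so pointwise strictness
survives the supremum. -/
lemma norm_lt_of_forall_sum_norm_sq_lt {n : Type*} [Fintype n] [DecidableEq n]
    (T : Matrix n n ℂ) {c : ℝ} (hc : 0 < c)
    (h : ∀ u : n → ℂ, u ≠ 0 → ∑ i, ‖(T *ᵥ u) i‖ ^ 2 < c ^ 2 * ∑ j, ‖u j‖ ^ 2) : ‖T‖ < c := by
  rcases isEmpty_or_nonempty n with hn | hn
  · have : T = 0 := by ext i; exact hn.elim i
    rw [this, norm_zero]; exact hc
  have hcpt : IsCompact (Metric.sphere (0 : EuclideanSpace ℂ n) 1) := isCompact_sphere _ _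
  have hne : (Metric.sphere (0 : EuclideanSpace ℂ n) 1).Nonempty :=
    NormedSpace.sphere_nonempty.2 zero_le_one
  set L := Matrix.toEuclideanCLM (n := n) (𝕜 := ℂ) T
  obtain ⟨u₀, hu₀, hmax⟩ := hcpt.exists_isMaxOn hne
    (f := fun u => ‖L u‖) (by fun_prop)
  have h1 : ‖L u₀‖ < c := by
    have hu1 : ‖u₀‖ = 1 := by simpa using hu₀
    have h2 := h u₀.ofLp (by
      intro h0
      have : u₀ = 0 := by ext i; exact congrFun h0 i
      simp [this] at hu1)
    have h3 : ‖L u₀‖ ^ 2 < c ^ 2 := by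
      have h4 : ‖u₀‖ ^ 2 = 1 := by rw [hu1]; norm_num
      rw [EuclideanSpace.norm_sq_eq] at h4 ⊢
      rw [h4, mul_one] at h2
      exact h2
    exact lt_of_pow_lt_pow_left₀ 2 hc.le h3
  refine lt_of_le_of_lt ?_ h1
  rw [Matrix.cstar_norm_def]
  refine ContinuousLinearMap.opNorm_le_bound _ (norm_nonneg _) fun u => ?_
  by_cases hu : u = 0
  · simp [hu]
  have hu' : ‖u‖ ≠ 0 := norm_ne_zero_iff.2 hu
  have h5 : ‖L (((‖u‖⁻¹ : ℝ) : ℂ) • u)‖ ≤ ‖L u₀‖ := hmax (by simp [norm_smul, hu'])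
  rw [map_smul, norm_smul] at h5
  simp only [Complex.norm_real, norm_inv, norm_norm] at h5
  rw [inv_mul_le_iff₀ (by positivity)] at h5
  linarith

lemma cantorNorm_lt (hM : 0 < M) {k : ℕ} {c : ℝ} (hc : 0 < c)
    (h : ∀ u : ℕ → ℂ, (∃ x ∈ cantorNat M A k, u x ≠ 0) → ∑ y ∈ cantorNat M A k,
      ‖∑ x ∈ cantorNat M A k, psi (M ^ k) (y * x) * u x‖ ^ 2
        < c ^ 2 * M ^ k * ∑ x ∈ cantorNat M A k, ‖u x‖ ^ 2) : cantorNorm M A k < c := by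
  rw [cantorNorm_eq]
  refine norm_lt_of_forall_sum_norm_sq_lt _ hc fun v hv => ?_
  have hp : (0 : ℝ) < M ^ k := by positivity
  refine lt_of_mul_lt_mul_left ?_ hp.le
  rw [cantor_mulVec_eq_restrict,
    sum_norm_sq_cantor_mulVec hM k fun x => if h : x < M ^ k then v ⟨x, h⟩ else 0]
  by_cases hx : ∃ x ∈ cantorNat M A k, (if h : x < M ^ k then v ⟨x, h⟩ else 0) ≠ 0
  · refine (h _ hx).trans_le ?_
    rw [← mul_assoc, mul_comm (c ^ 2)]
    gcongr
    exact sum_cantorNat_dite_le k v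
  -- When `v` vanishes on the Cantor set the left side is zero, and the right side is positive
  -- because `v ≠ 0`.
  · push Not at hx
    have h0 : ∀ y : ℕ, ∑ x ∈ cantorNat M A k, psi (M ^ k) (y * x) *
        (if h : x < M ^ k then v ⟨x, h⟩ else 0) = 0 :=
      fun y => Finset.sum_eq_zero fun x h => by rw [hx x h, mul_zero]
    simp only [h0, norm_zero]
    obtain ⟨i, hi⟩ := Function.ne_iff.1 hv
    have : 0 < ∑ j, ‖v j‖ ^ 2 := Finset.sum_pos' (fun _ _ => by positivity)
      ⟨i, Finset.mem_univ i, by have := norm_pos_iff.2 hi; positivity⟩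
    simp only [ne_eq, OfNat.ofNat_ne_zero, not_false_eq_true, zero_pow, Finset.sum_const_zero]
    positivity

/-! ### Submultiplicativity and the trivial bounds. -/

/-- Of the four products in the phase, `r * p` carries the full factor `M ^ (k₁ + k₂)` and
disappears; only `s * q` still couples the two scales. -/
lemma psi_split (hM : 0 < M) (k₁ k₂ : ℕ) (r s p q : ℤ) :
    psi (M ^ (k₁ + k₂)) ((M ^ k₂ * r + s) * (M ^ k₁ * p + q))
      = psi (M ^ k₁) (r * q) * (psi (M ^ (k₁ + k₂)) (s * q) * psi (M ^ k₂) (s * p)) := by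
  have h1 : (M ^ k₁ : ℕ) ≠ 0 := by positivity
  have h2 : (M ^ k₂ : ℕ) ≠ 0 := by positivity
  rw [← psi_mul_left h2 (r * q), ← psi_mul_left h1 (s * p), mul_comm (M ^ k₂) (M ^ k₁), ← pow_add,
    ← psi_add, ← psi_add]
  have h3 := psi_mul_self (N := M ^ (k₁ + k₂)) (by positivity) (r * p)
  rw [show ((M ^ k₂ * r + s) * (M ^ k₁ * p + q) : ℤ) = (M ^ (k₁ + k₂) : ℕ) * (r * p) +
    (r * q * (M ^ k₂ : ℕ) + (s * q + s * p * (M ^ k₁ : ℕ))) by push_cast; rw [pow_add]; ring,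
    psi_add, h3, one_mul]

/-- Submultiplicativity of the norms `r_k`. -/
lemma cantorNorm_add_le (hM : 0 < M) (k₁ k₂ : ℕ) :
    cantorNorm M A (k₁ + k₂) ≤ cantorNorm M A k₁ * cantorNorm M A k₂ := by
  set c₁ := cantorNorm M A k₁
  set c₂ := cantorNorm M A k₂
  refine cantorNorm_le hM (mul_nonneg (cantorNorm_nonneg _ _ _) (cantorNorm_nonneg _ _ _))
    fun u => ?_
  have e1 : ∑ y ∈ cantorNat M A (k₁ + k₂),
      ‖∑ x ∈ cantorNat M A (k₁ + k₂), psi (M ^ (k₁ + k₂)) (y * x) * u x‖ ^ 2 =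
      ∑ s ∈ cantorNat M A k₂, ∑ r ∈ cantorNat M A k₁, ‖∑ q ∈ cantorNat M A k₁,
        psi (M ^ k₁) (r * q) * (psi (M ^ (k₁ + k₂)) (s * q) *
          ∑ p ∈ cantorNat M A k₂, psi (M ^ k₂) (s * p) * u (M ^ k₁ * p + q))‖ ^ 2 := by
    -- The output `y` is cut with `k₁` high digits `r` and `k₂` low digits `s`, opposite to the
    -- input, hence the commutation.
    conv_lhs => rw [add_comm k₁ k₂, sum_cantorNat_add, Finset.sum_comm]
    refine Finset.sum_congr rfl fun s _ => Finset.sum_congr rfl fun r _ => ?_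
    congr 2
    rw [add_comm k₂ k₁, sum_cantorNat_add, Finset.sum_comm]
    refine Finset.sum_congr rfl fun q _ => ?_
    rw [Finset.mul_sum, Finset.mul_sum]
    refine Finset.sum_congr rfl fun p _ => ?_
    have := psi_split hM k₁ k₂ r s p q
    push_cast
    rw [this]
    ring
  have e2 : ∀ s ∈ cantorNat M A k₂, ∑ r ∈ cantorNat M A k₁, ‖∑ q ∈ cantorNat M A k₁,
        psi (M ^ k₁) (r * q) * (psi (M ^ (k₁ + k₂)) (s * q) *
          ∑ p ∈ cantorNat M A k₂, psi (M ^ k₂) (s * p) * u (M ^ k₁ * p + q))‖ ^ 2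
      ≤ c₁ ^ 2 * M ^ k₁ * ∑ q ∈ cantorNat M A k₁,
        ‖∑ p ∈ cantorNat M A k₂, psi (M ^ k₂) (s * p) * u (M ^ k₁ * p + q)‖ ^ 2 := fun s _ => by
    refine (sum_norm_sq_cantor_le hM k₁ fun q => psi (M ^ (k₁ + k₂)) (s * q) *
          ∑ p ∈ cantorNat M A k₂, psi (M ^ k₂) (s * p) * u (M ^ k₁ * p + q)).trans (le_of_eq ?_)
    -- The twist by `s * q` is unimodular and drops out of the norms.
    simp only [norm_mul, norm_psi, one_mul]
    rfl
  rw [e1]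
  refine (Finset.sum_le_sum e2).trans ?_
  rw [← Finset.mul_sum, Finset.sum_comm]
  have e3 : ∀ q ∈ cantorNat M A k₁, ∑ s ∈ cantorNat M A k₂,
      ‖∑ p ∈ cantorNat M A k₂, psi (M ^ k₂) (s * p) * u (M ^ k₁ * p + q)‖ ^ 2
      ≤ c₂ ^ 2 * M ^ k₂ * ∑ p ∈ cantorNat M A k₂, ‖u (M ^ k₁ * p + q)‖ ^ 2 := fun q _ =>
    sum_norm_sq_cantor_le hM k₂ fun p => u (M ^ k₁ * p + q)
  refine (mul_le_mul_of_nonneg_left (Finset.sum_le_sum e3) (by positivity)).trans (le_of_eq ?_)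
  rw [← Finset.mul_sum, sum_cantorNat_add, Finset.sum_comm (s := cantorNat M A k₁), pow_add]
  ring

/-- A diagonal entry at a point of the Cantor set already has this modulus. It keeps the subadditive
limit finite. -/
lemma inv_sqrt_le_cantorNorm (hA : A.Nonempty) (k : ℕ) :
    1 / Real.sqrt ((M : ℝ) ^ k) ≤ cantorNorm M A k := by
  obtain ⟨x, hx⟩ := cantorNat_nonempty hA k
  have h := norm_apply_le (indicatorOp (cantorSet M A k) * fourier (M ^ k) *
    indicatorOp (cantorSet M A k)) ⟨x, cantorNat_lt hx⟩ ⟨x, cantorNat_lt hx⟩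
  rw [indicatorOp_mul_mul_apply, mem_cantorSet_iff, if_pos ⟨hx, hx⟩, norm_fourier_apply] at h
  rw [cantorNorm_eq]
  simpa using h

/-- The Parseval bound over all frequencies. Compared with the sum over Cantor frequencies alone, it
controls the mass off the Cantor set. -/
lemma sum_norm_sq_fin_le (hM : 0 < M) (k : ℕ) (u : ℕ → ℂ) :
    ∑ y : Fin (M ^ k), ‖∑ x ∈ cantorNat M A k, psi (M ^ k) ((y : ℕ) * x) * u x‖ ^ 2
      ≤ M ^ k * ∑ x ∈ cantorNat M A k, ‖u x‖ ^ 2 := by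
  have hp : (0 : ℝ) < M ^ k := by positivity
  have h := sum_norm_sq_mulVec_le (fourier (M ^ k)) fun i : Fin (M ^ k) =>
    if (i : ℕ) ∈ cantorNat M A k then u i else 0
  have hF : ‖fourier (M ^ k)‖ ^ 2 ≤ 1 := pow_le_one₀ (norm_nonneg _) (norm_fourier_le _)
  have e2 : ∑ i : Fin (M ^ k), ‖(if (i : ℕ) ∈ cantorNat M A k then u i else 0)‖ ^ 2
      = ∑ x ∈ cantorNat M A k, ‖u x‖ ^ 2 := by
    rw [← sum_fin_ite_mem (cantorNat M A k) (fun _ => cantorNat_lt)]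
    exact Finset.sum_congr rfl fun i _ => by split_ifs <;> simp
  rw [e2] at h
  have e1 : ∀ y : Fin (M ^ k), ‖∑ x ∈ cantorNat M A k, psi (M ^ k) ((y : ℕ) * x) * u x‖ ^ 2 =
      M ^ k * ‖(fourier (M ^ k) *ᵥ fun i : Fin (M ^ k) =>
        if (i : ℕ) ∈ cantorNat M A k then u i else 0) y‖ ^ 2 := fun y => by
    have : (fourier (M ^ k) *ᵥ fun i : Fin (M ^ k) =>
        if (i : ℕ) ∈ cantorNat M A k then u i else 0) y = (1 / (Real.sqrt (M ^ k : ℕ) : ℂ)) *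
          ∑ x ∈ cantorNat M A k, psi (M ^ k) ((y : ℕ) * x) * u x := by
      rw [← sum_fin_ite_mem (cantorNat M A k) (fun _ => cantorNat_lt), Finset.mul_sum,
        Matrix.mulVec, dotProduct]
      refine Finset.sum_congr rfl fun i _ => ?_
      rw [fourier_apply]
      split_ifs
      · ring
      · simp
    rw [this, norm_mul, mul_pow, norm_div, norm_one, Complex.norm_real, Real.norm_eq_abs, div_pow,
      sq_abs, Real.sq_sqrt (by positivity)]
    push_cast
    field_simp
  simp only [e1]
  rw [← Finset.mul_sum]
  gcongr
  refine h.trans ?_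
  have : 0 ≤ ∑ x ∈ cantorNat M A k, ‖u x‖ ^ 2 := by positivity
  nlinarith

/-! ### Strict improvement over both trivial bounds, and the exponent. -/

/-- A vector with support of size at most `m` whose transform vanishes at `m` consecutive points
is zero. -/
lemma eq_zero_of_sum_psi_eq_zero {N m y₀ : ℕ} (hN : N ≠ 0) (S : Finset ℕ) (hS : ∀ x ∈ S, x < N)
    (hm : S.card ≤ m) (u : ℕ → ℂ)
    (h : ∀ t < m, ∑ x ∈ S, psi N ((y₀ + t : ℕ) * x) * u x = 0) : ∀ x ∈ S, u x = 0 := by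
  -- A Vandermonde system with nodes `psi N x`, distinct because `S` lies in `[0, N)`. The shift
  -- `y₀` only multiplies the unknowns by unimodular factors.
  have key := Matrix.eq_zero_of_forall_pow_sum_mul_pow_eq_zero
    (f := fun j : Fin S.card => psi N ((S.equivFin.symm j : ℕ) : ℤ))
    (v := fun j => psi N (y₀ * (S.equivFin.symm j : ℕ)) * u (S.equivFin.symm j)) ?_ ?_
  · intro x hx
    have := congrFun key (S.equivFin ⟨x, hx⟩)
    simp only [Equiv.symm_apply_apply, Pi.zero_apply, mul_eq_zero, psi_ne_zero, false_or] at this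
    exact this
  · intro j j' hj
    simp only at hj
    have h1 : psi N (((S.equivFin.symm j : ℕ) : ℤ) - ((S.equivFin.symm j' : ℕ) : ℤ)) = 1 := by
      rw [sub_eq_add_neg, psi_add, hj, psi_neg, mul_comm, star_psi_mul_self]
    rw [psi_eq_one_iff hN] at h1
    have a1 := hS _ (S.equivFin.symm j).2
    have a2 := hS _ (S.equivFin.symm j').2
    have := Int.eq_zero_of_abs_lt_dvd h1 (by rw [abs_lt]; constructor <;> omega)
    apply S.equivFin.symm.injective
    ext
    omega
  · intro i
    have h2 := h i (i.2.trans_le hm)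
    rw [← Finset.sum_coe_sort, ← S.equivFin.symm.sum_comp] at h2
    rw [← h2]
    refine Finset.sum_congr rfl fun j _ => ?_
    rw [psi_pow, mul_right_comm, ← psi_add]
    congr 2
    push_cast
    ring

/-- Without strict loss, all the Fourier mass of some nonzero `u` sits on the Cantor set. The
transform then vanishes on the whole block with leading digit `d ∉ A`, which by `hk` is at least as
long as the support of `u`. -/
lemma cantorNorm_lt_one (hAM : A.card < M) {k : ℕ} (hk : A.card ^ (k + 1) ≤ M ^ k) :
    cantorNorm M A (k + 1) < 1 := by
  have hM : 0 < M := by omega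
  have hN : M ^ (k + 1) ≠ 0 := by positivity
  obtain ⟨d, hd⟩ : ∃ d : Fin M, d ∉ A := by
    by_contra! h
    have : A = Finset.univ := Finset.eq_univ_of_forall h
    rw [this, Finset.card_univ, Fintype.card_fin] at hAM
    omega
  refine cantorNorm_lt hM one_pos fun u ⟨x, hx, hux⟩ => ?_
  by_contra! hle
  rw [one_pow, one_mul] at hle
  apply hux
  refine eq_zero_of_sum_psi_eq_zero (m := M ^ k) (y₀ := (d : ℕ) * M ^ k) hN (cantorNat M A (k + 1))
    (fun _ => cantorNat_lt) (by rw [card_cantorNat]; exact hk) u (fun t ht => ?_) x hx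
  have htot := (sum_norm_sq_fin_le (A := A) hM (k + 1) u).trans hle
  set g : ℕ → ℝ := fun y =>
    ‖∑ x ∈ cantorNat M A (k + 1), psi (M ^ (k + 1)) (y * x) * u x‖ ^ 2 with hg
  have hlt : (d : ℕ) * M ^ k + t < M ^ (k + 1) := by
    have h2 : ((d : ℕ) + 1) * M ^ k ≤ M * M ^ k := Nat.mul_le_mul_right _ d.2
    rw [pow_succ]
    nlinarith
  have hnot : (d : ℕ) * M ^ k + t ∉ cantorNat M A (k + 1) := by
    rw [mem_cantorNat_succ]
    rintro ⟨a, ha, c, hc, he⟩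
    have hc' := cantorNat_lt hc
    have e1 := congrArg (· / M ^ k) he
    simp only [mul_comm _ (M ^ k), Nat.mul_add_div (Nat.pow_pos hM), Nat.div_eq_of_lt ht,
      Nat.div_eq_of_lt hc', add_zero] at e1
    exact hd (Fin.ext e1 ▸ ha)
  have hsum : g (d * M ^ k + t) + ∑ y ∈ cantorNat M A (k + 1), g y
      ≤ ∑ y : Fin (M ^ (k + 1)), g y := by
    rw [Fin.sum_univ_eq_sum_range g, ← Finset.sum_insert hnot]
    refine Finset.sum_le_sum_of_subset_of_nonneg ?_ fun _ _ _ => by positivity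
    intro z hz
    rw [Finset.mem_insert] at hz
    rw [Finset.mem_range]
    rcases hz with rfl | hz
    · exact hlt
    · exact cantorNat_lt hz
  have h0 : g (d * M ^ k + t) ≤ 0 := by
    have : ∑ y : Fin (M ^ (k + 1)), g y ≤ ∑ y ∈ cantorNat M A (k + 1), g y := htot
    linarith
  have h1 : g (d * M ^ k + t) = 0 := le_antisymm h0 (by positivity)
  simpa [hg] using h1

/-- The variance identity. It contains both Cauchy–Schwarz against the constant vector and its
equality case. -/
lemma card_mul_sum_norm_sub_mean (S : Finset ℕ) (hS : S.Nonempty) (z : ℕ → ℂ) :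
    (S.card : ℝ) * ∑ x ∈ S, ‖z x - (∑ y ∈ S, z y) / S.card‖ ^ 2
      = S.card * ∑ x ∈ S, ‖z x‖ ^ 2 - ‖∑ x ∈ S, z x‖ ^ 2 := by
  have hc : (S.card : ℂ) ≠ 0 := by simpa using hS.ne_empty
  apply Complex.ofReal_injective
  push_cast
  simp only [← Complex.mul_conj', map_sub, map_div₀, map_natCast, sub_mul, mul_sub,
    Finset.sum_sub_distrib, ← Finset.sum_mul, ← Finset.mul_sum, ← map_sum, Finset.sum_const,
    nsmul_eq_mul]
  field_simp
  ring

lemma norm_sq_sum_le (S : Finset ℕ) (z : ℕ → ℂ) :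
    ‖∑ x ∈ S, z x‖ ^ 2 ≤ S.card * ∑ x ∈ S, ‖z x‖ ^ 2 := by
  rcases S.eq_empty_or_nonempty with rfl | hS
  · simp
  have := card_mul_sum_norm_sub_mean S hS z
  have h : 0 ≤ (S.card : ℝ) * ∑ x ∈ S, ‖z x - (∑ y ∈ S, z y) / S.card‖ ^ 2 := by positivity
  linarith

lemma eq_of_card_mul_le_norm_sq_sum (S : Finset ℕ) (z : ℕ → ℂ)
    (h : S.card * ∑ x ∈ S, ‖z x‖ ^ 2 ≤ ‖∑ x ∈ S, z x‖ ^ 2) {x y : ℕ} (hx : x ∈ S) (hy : y ∈ S) :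
    z x = z y := by
  have h1 := card_mul_sum_norm_sub_mean S ⟨x, hx⟩ z
  have hc : (0 : ℝ) < S.card := by exact_mod_cast Finset.card_pos.2 ⟨x, hx⟩
  have h2 : ∑ x ∈ S, ‖z x - (∑ y ∈ S, z y) / S.card‖ ^ 2 = 0 :=
    le_antisymm (by by_contra! h3; nlinarith) (by positivity)
  rw [Finset.sum_eq_zero_iff_of_nonneg (fun _ _ => by positivity)] at h2
  have h3 := h2 x hx
  have h4 := h2 y hy
  simp only [ne_eq, OfNat.ofNat_ne_zero, not_false_eq_true, pow_eq_zero_iff, norm_eq_zero,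
    sub_eq_zero] at h3 h4
  rw [h3, h4]

/-- The right side is the Hilbert–Schmidt norm: `|A|²` rows and columns with entries of modulus `1 /
M`. Equality for some `u ≠ 0` makes every row proportional to the conjugate of `u`, and then all two
by two minors vanish. -/
lemma cantorNorm_two_lt (hA : 1 < A.card) : cantorNorm M A 2 < (A.card : ℝ) ^ 2 / M := by
  obtain ⟨a, ha, b, hb, hab⟩ := Finset.one_lt_card.1 hA
  have hM : 0 < M := a.pos
  have hM' : (M : ℝ) ≠ 0 := by positivity
  refine cantorNorm_lt hM (by have : 0 < A.card := by omega
                              positivity) fun u ⟨x₀, hx₀, hu₀⟩ => ?_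
  set S := cantorNat M A 2 with hS
  have hcard : (S.card : ℝ) = (A.card : ℝ) ^ 2 := by rw [hS, card_cantorNat]; push_cast; rfl
  have hRHS : ((A.card : ℝ) ^ 2 / M) ^ 2 * M ^ 2 * ∑ x ∈ S, ‖u x‖ ^ 2
      = ∑ y ∈ S, (S.card * ∑ x ∈ S, ‖u x‖ ^ 2 : ℝ) := by
    rw [Finset.sum_const, nsmul_eq_mul, hcard]
    field_simp
  rw [hRHS]
  have hle : ∀ y ∈ S, ‖∑ x ∈ S, psi (M ^ 2) (y * x) * u x‖ ^ 2 ≤ S.card * ∑ x ∈ S, ‖u x‖ ^ 2 :=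
    fun y _ => by
      refine (norm_sq_sum_le S _).trans (le_of_eq ?_)
      simp only [norm_mul, norm_psi, one_mul]
  by_contra hnot
  have heq : ∀ y ∈ S, S.card * ∑ x ∈ S, ‖u x‖ ^ 2 ≤ ‖∑ x ∈ S, psi (M ^ 2) (y * x) * u x‖ ^ 2 := by
    by_contra! h
    obtain ⟨y, hy, hlt⟩ := h
    exact hnot (Finset.sum_lt_sum hle ⟨y, hy, hlt⟩)
  have hconst : ∀ y ∈ S, ∀ x ∈ S, ∀ x' ∈ S, psi (M ^ 2) (y * x) * u x = psi (M ^ 2) (y * x') * u x' :=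
    fun y hy x hx x' hx' => eq_of_card_mul_le_norm_sq_sum S (fun x => psi (M ^ 2) (y * x) * u x) (by
      simp only [norm_mul (psi _ _), norm_psi, one_mul]
      exact heq y hy) hx hx'
  have hmem : ∀ d ∈ A, (a : ℕ) * M ^ 1 + d ∈ S := fun d hd =>
    mem_cantorNat_succ.2 ⟨a, ha, d, mem_cantorNat_succ.2 ⟨d, hd, 0, by simp [cantorNat], by simp⟩,
      rfl⟩
  -- These points share their leading digit, so they differ by less than `M` and the square of the
  -- difference is below `M ^ 2`. This is why order two is used.
  set x₁ := (a : ℕ) * M ^ 1 + a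
  set x₂ := (a : ℕ) * M ^ 1 + b
  have e1 := hconst x₁ (hmem a ha) x₁ (hmem a ha) x₂ (hmem b hb)
  have e2 := hconst x₂ (hmem b hb) x₁ (hmem a ha) x₂ (hmem b hb)
  have e3 := hconst x₁ (hmem a ha) x₀ hx₀ x₁ (hmem a ha)
  have hu1 : u x₁ ≠ 0 := by
    intro h
    rw [h, mul_zero, mul_eq_zero] at e3
    exact e3.elim (psi_ne_zero _ _) hu₀
  have hu2 : u x₂ ≠ 0 := by
    intro h
    rw [h, mul_zero, mul_eq_zero] at e1
    exact e1.elim (psi_ne_zero _ _) hu1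
  -- The vanishing minor with rows and columns `x₁`, `x₂`; it makes `psi (M ^ 2)` equal to one at
  -- `(a - b) ^ 2`.
  have e4 : psi (M ^ 2) (x₁ * x₁ + x₂ * x₂) = psi (M ^ 2) (x₁ * x₂ + x₂ * x₁) := by
    rw [psi_add, psi_add]
    have : (psi (M ^ 2) (x₁ * x₁) * psi (M ^ 2) (x₂ * x₂) - psi (M ^ 2) (x₁ * x₂)
        * psi (M ^ 2) (x₂ * x₁)) * (u x₁ * u x₂) = 0 := by
      linear_combination (psi (M ^ 2) (x₂ * x₂) * u x₂) * e1
        - (psi (M ^ 2) (x₁ * x₂) * u x₂) * e2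
    rcases mul_eq_zero.1 this with h | h
    · exact sub_eq_zero.1 h
    · exact absurd h (mul_ne_zero hu1 hu2)
  have e5 : psi (M ^ 2) (((a : ℕ) - (b : ℕ) : ℤ) ^ 2) = 1 := by
    have h1 : (x₁ * x₁ + x₂ * x₂ : ℤ) = ((a : ℕ) - (b : ℕ) : ℤ) ^ 2 + (x₁ * x₂ + x₂ * x₁) := by
      simp only [x₁, x₂]; push_cast; ring
    rw [h1, psi_add] at e4
    exact mul_right_cancel₀ (psi_ne_zero _ _) (e4.trans (one_mul _).symm)
  rw [psi_eq_one_iff (by positivity)] at e5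
  have hab' : ((a : ℕ) : ℤ) ≠ (b : ℕ) := fun h => hab (Fin.ext (by exact_mod_cast h))
  have ha2 := a.2
  have hb2 := b.2
  have habs : |((a : ℕ) - (b : ℕ) : ℤ)| < |(M : ℤ)| := by
    rw [Nat.abs_cast, abs_lt]; constructor <;> omega
  have h0 := Int.eq_zero_of_abs_lt_dvd e5 (by
    rw [abs_of_nonneg (sq_nonneg _)]
    push_cast
    exact sq_lt_sq.2 habs)
  exact hab' (sub_eq_zero.1 (pow_eq_zero_iff two_ne_zero |>.1 h0))

lemma exists_card_pow_le (hA : 0 < A.card) (hAM : A.card < M) : ∃ k, A.card ^ (k + 1) ≤ M ^ k := by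
  have hM : (0 : ℝ) < M := by have : 0 < M := by omega
                              exact_mod_cast this
  obtain ⟨k, hk⟩ := exists_pow_lt_of_lt_one (show (0 : ℝ) < 1 / A.card by positivity)
    (show (A.card : ℝ) / M < 1 by rw [div_lt_one hM]; exact_mod_cast hAM)
  refine ⟨k, ?_⟩
  rw [div_pow, div_lt_div_iff₀ (by positivity) (by positivity), one_mul, ← pow_succ] at hk
  exact_mod_cast hk.le

lemma cantorNorm_pos (hM : 0 < M) (hA : A.Nonempty) (k : ℕ) : 0 < cantorNorm M A k :=
  lt_of_lt_of_le (by positivity) (inv_sqrt_le_cantorNorm hA k)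

/-- The exponent `β` exists and improves on both trivial bounds. -/
theorem exists_cantorNorm_exponent (hA1 : 1 < A.card) (hAM : A.card < M) : ∃ β : ℝ,
    Tendsto (fun k : ℕ => -(Real.log (cantorNorm M A k) / ((k : ℝ) * Real.log (M : ℝ))))
      atTop (𝓝 β) ∧ max 0 (1 / 2 - dimension M A) < β := by
  have hM0 : 0 < M := by omega
  have hA : A.Nonempty := Finset.card_pos.1 (by omega)
  have hpos := cantorNorm_pos hM0 hA
  have hM1 : (1 : ℝ) < M := by exact_mod_cast (by omega : 1 < M)
  have hlog : 0 < Real.log M := Real.log_pos hM1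
  have hsub : Subadditive fun k => Real.log (cantorNorm M A k) := fun m n => by
    rw [← Real.log_mul (hpos m).ne' (hpos n).ne']
    exact Real.log_le_log (hpos _) (cantorNorm_add_le hM0 m n)
  have hbdd : BddBelow (Set.range fun n : ℕ => Real.log (cantorNorm M A n) / n) := by
    refine ⟨-(Real.log M / 2), ?_⟩
    rintro _ ⟨n, rfl⟩
    simp only
    rcases Nat.eq_zero_or_pos n with rfl | hn
    · simp only [Nat.cast_zero, div_zero]; linarith
    have h1 := Real.log_le_log (by positivity) (inv_sqrt_le_cantorNorm (M := M) hA n)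
    rw [one_div, Real.log_inv, Real.log_sqrt (by positivity), Real.log_pow] at h1
    rw [le_div_iff₀ (by positivity)]
    linarith
  have hlim := hsub.tendsto_lim hbdd
  refine ⟨-(hsub.lim / Real.log M), ?_, ?_⟩
  · refine ((hlim.div_const (Real.log M)).neg).congr fun k => ?_
    rw [div_div]
  · rw [max_lt_iff]
    constructor
    -- The subadditive limit is an infimum, so a single order with norm below one is enough.
    · obtain ⟨k, hk⟩ := exists_card_pow_le (by omega) hAM
      have h1 := hsub.lim_le_div hbdd (Nat.succ_ne_zero k)
      have h2 : Real.log (cantorNorm M A (k + 1)) / (k + 1 : ℕ) < 0 :=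
        div_neg_of_neg_of_pos (Real.log_neg (hpos _) (cantorNorm_lt_one hAM hk)) (by positivity)
      have h3 := div_neg_of_neg_of_pos (h1.trans_lt h2) hlog
      linarith
    -- Half of `log (|A|² / M)` is `(δ - 1/2) log M`.
    · have h1 := hsub.lim_le_div hbdd two_ne_zero
      have hAc : (0 : ℝ) < A.card := by exact_mod_cast (by omega : 0 < A.card)
      have h2 := Real.log_lt_log (hpos 2) (cantorNorm_two_lt hA1)
      rw [Real.log_div (by positivity) (by positivity), Real.log_pow] at h2
      rw [dimension]
      rw [lt_neg, neg_sub]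
      push_cast at h1 h2
      calc hsub.lim / Real.log M < (Real.log A.card - Real.log M / 2) / Real.log M := by
            gcongr
            linarith
        _ = _ := by field_simp

end Cantor

end OpenBaker

namespace OpenBaker

open scoped Matrix.Norms.L2Operator

/-! ### Nonstationary phase for smoothly cut off exponential sums. -/

section Decay

/-- The backward difference operator of step `h`. -/
def backDiff (h : ℝ) (f : ℝ → ℝ) (x : ℝ) : ℝ := f (x - h) - f x

lemma hasDerivAt_iterate_backDiff (h : ℝ) {f : ℝ → ℝ} (hf : Differentiable ℝ f) (L : ℕ) (x : ℝ) :
    HasDerivAt ((backDiff h)^[L] f) ((backDiff h)^[L] (deriv f) x) x := by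
  induction L generalizing x with
  | zero => exact (hf x).hasDerivAt
  | succ L ih =>
    rw [Function.iterate_succ_apply', Function.iterate_succ_apply']
    have h1 := (ih (x - h)).comp_sub_const x h
    exact h1.sub (ih x)

/-- The mean value theorem trades one difference for one derivative and a factor `h`; the hypotheses
pass to `deriv f`, so the induction runs over all `f`. -/
lemma exists_abs_iterate_backDiff_le (L : ℕ) {f : ℝ → ℝ} (hf : ContDiff ℝ ∞ f)
    (hc : HasCompactSupport f) :
    ∃ C : ℝ, 0 ≤ C ∧ ∀ h, 0 ≤ h → ∀ x, |(backDiff h)^[L] f x| ≤ C * h ^ L := by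
  induction L generalizing f with
  | zero =>
    obtain ⟨C, hC⟩ := hf.continuous.bounded_above_of_compact_support hc
    refine ⟨C, (norm_nonneg _).trans (hC 0), fun h _ x => ?_⟩
    simpa using hC x
  | succ L ih =>
    obtain ⟨C, hC0, hC⟩ := ih (f := deriv f) (contDiff_infty_iff_deriv.1 hf).2 hc.deriv
    refine ⟨C, hC0, fun h hh x => ?_⟩
    rw [Function.iterate_succ_apply']
    have hd := hasDerivAt_iterate_backDiff h (contDiff_infty_iff_deriv.1 hf).1 L
    have := Convex.norm_image_sub_le_of_norm_hasDerivWithin_le (s := Set.univ)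
      (f := (backDiff h)^[L] f) (x := x) (y := x - h)
      (fun x _ => (hd x).hasDerivWithinAt) (fun x _ => hC h hh x) convex_univ
      (Set.mem_univ _) (Set.mem_univ _)
    rw [backDiff]
    refine this.trans (le_of_eq ?_)
    rw [sub_sub_cancel_left, norm_neg, Real.norm_of_nonneg hh, pow_succ, mul_assoc]

/-- Summation by parts, without boundary terms since `f` vanishes at both ends. Each difference
moves the right end of the support one step, whence the slack demanded of `K`. -/
lemma sub_one_mul_sum_eq (f : ℝ → ℝ) {h : ℝ} (hh : 0 < h) (z : ℂ) {T K : ℕ}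
    (hf0 : ∀ x ≤ 0, f x = 0) (hfT : ∀ x, T * h ≤ x → f x = 0) (hK : T + 1 ≤ K) :
    (z - 1) * ∑ j ∈ Finset.range K, (f (j * h) : ℂ) * z ^ j
      = ∑ j ∈ Finset.range K, (backDiff h f (j * h) : ℂ) * z ^ j := by
  obtain ⟨K, rfl⟩ : ∃ K', K = K' + 1 := ⟨K - 1, by omega⟩
  have h1 : ∑ j ∈ Finset.range (K + 1), (f (j * h - h) : ℂ) * z ^ j
      = z * ∑ j ∈ Finset.range (K + 1), (f (j * h) : ℂ) * z ^ j := by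
    rw [Finset.sum_range_succ', Finset.sum_range_succ, hfT (K * h) (by
      have : (T : ℝ) ≤ K := by exact_mod_cast (by omega : T ≤ K)
      gcongr), hf0 (((0 : ℕ) : ℝ) * h - h) (by simp [hh.le])]
    simp only [Complex.ofReal_zero, zero_mul, add_zero]
    rw [Finset.mul_sum]
    refine Finset.sum_congr rfl fun j _ => ?_
    rw [show ((j + 1 : ℕ) : ℝ) * h - h = j * h by push_cast; ring, pow_succ]
    ring
  simp only [backDiff, Complex.ofReal_sub, sub_mul, Finset.sum_sub_distrib]
  rw [h1]
  ring

lemma sub_one_pow_mul_sum_eq (L : ℕ) (f : ℝ → ℝ) {h : ℝ} (hh : 0 < h) (z : ℂ) {T K : ℕ}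
    (hf0 : ∀ x ≤ 0, f x = 0) (hfT : ∀ x, T * h ≤ x → f x = 0) (hK : T + L + 1 ≤ K) :
    (z - 1) ^ L * ∑ j ∈ Finset.range K, (f (j * h) : ℂ) * z ^ j
      = ∑ j ∈ Finset.range K, ((backDiff h)^[L] f (j * h) : ℂ) * z ^ j := by
  induction L generalizing f T with
  | zero => simp
  | succ L ih =>
    rw [pow_succ, mul_assoc, sub_one_mul_sum_eq f hh z hf0 hfT (by omega),
      Function.iterate_succ_apply]
    refine ih (backDiff h f) (T := T + 1) (fun x hx => ?_) (fun x hx => ?_) (by omega)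
    · rw [backDiff, hf0 x hx, hf0 (x - h) (by linarith), sub_zero]
    · push_cast at hx
      rw [backDiff, hfT x (by nlinarith), hfT (x - h) (by linarith), sub_zero]

/-- Nonstationary phase for exponential sums with a smooth cutoff. -/
lemma exists_norm_sum_cutoff_le {χ : ℝ → ℝ} (hχ : IsCutoff χ) (L : ℕ) :
    ∃ C : ℝ, 0 ≤ C ∧ ∀ n : ℕ, 0 < n → ∀ z : ℂ, ‖z‖ = 1 →
      (n * ‖z - 1‖) ^ L * ‖∑ j : Fin n, (χ ((j : ℕ) / n) : ℂ) * z ^ (j : ℕ)‖ ≤ C * n := by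
  obtain ⟨C, hC0, hC⟩ := exists_abs_iterate_backDiff_le L hχ.smooth hχ.compactSupport
  have hout : ∀ x, x ∉ Set.Ioo (0 : ℝ) 1 → χ x = 0 := fun x hx =>
    image_eq_zero_of_notMem_tsupport fun h => hx (hχ.support_subset h)
  refine ⟨(L + 2) * C, by positivity, fun n hn z hz => ?_⟩
  have hn' : (0 : ℝ) < n := by exact_mod_cast hn
  -- The range is lengthened by `L + 1` zero terms to hold the spreading support of the iterated
  -- differences.
  have e1 : ∑ j : Fin n, (χ ((j : ℕ) / n) : ℂ) * z ^ (j : ℕ)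
      = ∑ j ∈ Finset.range (n + L + 1), (χ (j * (n : ℝ)⁻¹) : ℂ) * z ^ j := by
    rw [Fin.sum_univ_eq_sum_range (fun j => (χ ((j : ℕ) / n) : ℂ) * z ^ (j : ℕ))]
    simp only [div_eq_mul_inv]
    refine Finset.sum_subset (fun x hx => ?_) fun x _ hx => ?_
    · rw [Finset.mem_range] at hx ⊢; omega
    · rw [Finset.mem_range, not_lt] at hx
      rw [hout, Complex.ofReal_zero, zero_mul]
      intro h
      have h2 := h.2
      rw [← div_eq_mul_inv, div_lt_one hn'] at h2
      exact absurd (by exact_mod_cast h2 : x < n) (by omega)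
  have e2 := sub_one_pow_mul_sum_eq L χ (inv_pos.2 hn') z (T := n) (K := n + L + 1)
    (fun x hx => hout x fun h => by linarith [h.1])
    (fun x hx => hout x fun h => by rw [mul_inv_cancel₀ hn'.ne'] at hx; linarith [h.2]) le_rfl
  rw [e1, mul_pow, mul_assoc, ← norm_pow, ← norm_mul, e2]
  have e3 : ‖∑ j ∈ Finset.range (n + L + 1), ((backDiff (n : ℝ)⁻¹)^[L] χ (j * (n : ℝ)⁻¹) : ℂ) * z ^ j‖
      ≤ (n + L + 1 : ℕ) * (C * (n : ℝ)⁻¹ ^ L) := by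
    refine (norm_sum_le _ _).trans ?_
    rw [← Finset.card_range (n + L + 1), ← nsmul_eq_mul, Finset.card_range]
    refine (Finset.sum_le_card_nsmul _ _ (C * (n : ℝ)⁻¹ ^ L) fun j _ => ?_).trans (by simp)
    rw [norm_mul, norm_pow, hz, one_pow, mul_one, Complex.norm_real]
    exact hC _ (by positivity) _
  have e4 : ((n + L + 1 : ℕ) : ℝ) ≤ (L + 2) * n := by
    have : (1 : ℝ) ≤ n := by exact_mod_cast hn
    push_cast
    nlinarith [(Nat.cast_nonneg L : (0 : ℝ) ≤ L)]
  calc _ ≤ (n : ℝ) ^ L * ((n + L + 1 : ℕ) * (C * (n : ℝ)⁻¹ ^ L)) := by gcongr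
    _ = (n + L + 1 : ℕ) * C := by
        rw [inv_pow]; field_simp
    _ ≤ (L + 2) * n * C := by gcongr
    _ = _ := by ring

/-- The chord has length `2 |sin (π a / N)|`; Jordan's inequality applies on each half of `[0, π]`.
-/
lemma le_norm_psi_sub_one {N : ℕ} (hN : 0 < N) {a : ℤ} {w : ℝ} (hw : 0 ≤ w) (h1 : w ≤ |(a : ℝ)|)
    (h2 : |(a : ℝ)| ≤ N - w) : 4 * w / N ≤ ‖psi N a - 1‖ := by
  have hN' : (0 : ℝ) < N := by exact_mod_cast hN
  have hpi := Real.pi_pos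
  rw [psi_eq_exp, Complex.norm_exp_I_mul_ofReal_sub_one]
  have h3 : ‖2 * Real.sin (-(2 * Real.pi * a / N) / 2)‖ = 2 * |Real.sin (Real.pi * (|(a : ℝ)| / N))| := by
    rw [norm_mul, Real.norm_eq_abs, Real.norm_eq_abs, abs_two]
    congr 1
    rcases abs_cases (a : ℝ) with ⟨h, -⟩ | ⟨h, -⟩
    · rw [h, ← abs_neg, ← Real.sin_neg]; congr 2; ring
    · rw [h]; congr 2; ring
  rw [h3]
  set t := |(a : ℝ)| / N with ht
  have t0 : 0 ≤ t := by positivity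
  have tw : 0 ≤ w / N := by positivity
  have t1 : w / N ≤ t := by rw [ht]; gcongr
  have t2 : t ≤ 1 - w / N := by
    rw [ht, div_le_iff₀ hN', sub_mul, div_mul_cancel₀ _ hN'.ne']; linarith
  have key : 2 * (w / N) ≤ Real.sin (Real.pi * t) := by
    rcases le_total t (1 / 2) with h | h
    · have := Real.mul_le_sin (x := Real.pi * t) (by positivity) (by nlinarith)
      have e : 2 / Real.pi * (Real.pi * t) = 2 * t := by field_simp
      linarith
    · rw [← Real.sin_pi_sub, show Real.pi - Real.pi * t = Real.pi * (1 - t) by ring]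
      have := Real.mul_le_sin (x := Real.pi * (1 - t)) (mul_nonneg hpi.le (by linarith))
        (by nlinarith)
      have e : 2 / Real.pi * (Real.pi * (1 - t)) = 2 * (1 - t) := by field_simp
      linarith
  have := le_abs_self (Real.sin (Real.pi * t))
  rw [mul_div_assoc]
  linarith

end Decay

/-! ### Block structure, symmetry and kernel of the baker's map. -/

section Structure

variable {M N : ℕ}

/-- The index `j + a N/M`. -/
def blockIdx (h : M * (N / M) = N) (a : Fin M) (j : Fin (N / M)) : Fin N :=
  ⟨j + a * (N / M), by
    have h2 : ((a : ℕ) + 1) * (N / M) ≤ M * (N / M) := Nat.mul_le_mul_right _ a.2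
    have := j.2
    rw [h] at h2
    nlinarith⟩

lemma blockIdx_injective (h : M * (N / M) = N) {a b : Fin M} {j l : Fin (N / M)} :
    blockIdx h a j = blockIdx h b l ↔ a = b ∧ j = l := by
  constructor
  · intro he
    have h0 : 0 < N / M := j.pos
    have e0 : (j : ℕ) + a * (N / M) = l + b * (N / M) := congrArg Fin.val he
    have e1 := congrArg (· / (N / M)) e0
    have e2 := congrArg (· % (N / M)) e0
    simp only [Nat.add_mul_div_right _ _ h0, Nat.add_mul_mod_self_right,
      Nat.div_eq_of_lt j.2, Nat.div_eq_of_lt l.2, Nat.mod_eq_of_lt j.2, Nat.mod_eq_of_lt l.2,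
      zero_add] at e1 e2
    exact ⟨Fin.ext e1, Fin.ext e2⟩
  · rintro ⟨rfl, rfl⟩; rfl

lemma exists_blockIdx (h : M * (N / M) = N) (x : Fin N) : ∃ a j, blockIdx h a j = x := by
  have h0 : 0 < N / M := by
    rcases Nat.eq_zero_or_pos (N / M) with h1 | h1
    · rw [h1, mul_zero] at h; exact absurd x.2 (by omega)
    · exact h1
  refine ⟨⟨x / (N / M), Nat.div_lt_of_lt_mul (by rw [mul_comm, h]; exact x.2)⟩,
    ⟨x % (N / M), Nat.mod_lt _ h0⟩, Fin.ext ?_⟩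
  simp only [blockIdx]
  rw [mul_comm]
  exact Nat.mod_add_div _ _

lemma sum_blockIdx {E : Type*} [AddCommMonoid E] (h : M * (N / M) = N) (f : Fin N → E) :
    ∑ x, f x = ∑ a, ∑ j, f (blockIdx h a j) := by
  rw [← Fintype.sum_prod_type']
  refine (Fintype.sum_bijective (fun p : Fin M × Fin (N / M) => blockIdx h p.1 p.2) ⟨?_, ?_⟩ _ _
    fun _ => rfl).symm
  · rintro ⟨a, j⟩ ⟨b, l⟩ he
    obtain ⟨rfl, rfl⟩ := (blockIdx_injective h).1 he
    rfl
  · intro x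
    obtain ⟨a, j, rfl⟩ := exists_blockIdx h x
    exact ⟨(a, j), rfl⟩

/-- The kernel `χ 𝓕 χ` of one branch of the baker's map. -/
noncomputable def branch (χ : ℝ → ℝ) (n : ℕ) : Matrix (Fin n) (Fin n) ℂ :=
  cutoffOp χ n * fourier n * cutoffOp χ n

/-- The block diagonal part of the baker's map. -/
noncomputable def blockDiag (M : ℕ) (A : Finset (Fin M)) (χ : ℝ → ℝ) (N : ℕ) : Matrix (Fin N) (Fin N) ℂ :=
  ∑ a ∈ A, (proj M N a)ᴴ * branch χ (N / M) * proj M N a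

lemma bakerMap_eq (A : Finset (Fin M)) (χ : ℝ → ℝ) :
    bakerMap M A χ N = (fourier N)ᴴ * blockDiag M A χ N := by
  rw [bakerMap, blockDiag, Finset.mul_sum]
  refine Finset.sum_congr rfl fun a _ => ?_
  simp only [Matrix.mul_assoc, branch]

lemma proj_apply_blockIdx (h : M * (N / M) = N) (a b : Fin M) (j l : Fin (N / M)) :
    proj M N a j (blockIdx h b l) = if b = a ∧ l = j then 1 else 0 := by
  rw [proj]
  congr 1
  rw [eq_iff_iff, ← blockIdx_injective h, Fin.ext_iff]
  rfl

lemma blockDiag_apply (h : M * (N / M) = N) (A : Finset (Fin M)) (χ : ℝ → ℝ) (a b : Fin M)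
    (j l : Fin (N / M)) : blockDiag M A χ N (blockIdx h a j) (blockIdx h b l)
      = if a = b ∧ b ∈ A then branch χ (N / M) j l else 0 := by
  have key : ∀ d : Fin M, ((proj M N d)ᴴ * branch χ (N / M) * proj M N d)
      (blockIdx h a j) (blockIdx h b l) = if a = d ∧ b = d then branch χ (N / M) j l else 0 :=
    fun d => by
      simp only [Matrix.mul_apply, Matrix.conjTranspose_apply, proj_apply_blockIdx]
      by_cases ha : a = d <;> by_cases hb : b = d <;> simp [ha, hb]
  rw [blockDiag, Matrix.sum_apply]
  simp only [key]
  by_cases hab : a = b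
  · subst hab
    simp
  · rw [if_neg (by tauto)]
    exact Finset.sum_eq_zero fun d _ => if_neg fun hd => hab (hd.1.trans hd.2.symm)

lemma norm_cutoffOp_le {χ : ℝ → ℝ} (hχ : IsCutoff χ) (n : ℕ) : ‖cutoffOp χ n‖ ≤ 1 :=
  norm_diagonal_le_one fun i => by
    rw [Complex.norm_real, Real.norm_eq_abs, abs_le]
    have := hχ.mem_Icc ((i : ℕ) / n)
    exact ⟨by linarith [this.1], this.2⟩

lemma norm_branch_le {χ : ℝ → ℝ} (hχ : IsCutoff χ) (n : ℕ) : ‖branch χ n‖ ≤ 1 := by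
  have h1 := norm_cutoffOp_le hχ n
  have h2 := norm_fourier_le n
  calc ‖branch χ n‖ ≤ ‖cutoffOp χ n‖ * ‖fourier n‖ * ‖cutoffOp χ n‖ :=
        (norm_mul_le _ _).trans (by gcongr; exact norm_mul_le _ _)
    _ ≤ 1 * 1 * 1 := by gcongr
    _ = 1 := by norm_num

/-- The blocks act on mutually orthogonal coordinate subspaces, each as a contraction. -/
lemma norm_blockDiag_le (h : M * (N / M) = N) (A : Finset (Fin M)) {χ : ℝ → ℝ} (hχ : IsCutoff χ) :
    ‖blockDiag M A χ N‖ ≤ 1 := by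
  refine norm_le_of_sum_norm_sq_mulVec_le _ zero_le_one fun u => ?_
  rw [one_pow, one_mul, sum_blockIdx h, sum_blockIdx h (fun x => ‖u x‖ ^ 2)]
  refine Finset.sum_le_sum fun a _ => ?_
  have e1 : ∀ j, (blockDiag M A χ N *ᵥ u) (blockIdx h a j)
      = if a ∈ A then (branch χ (N / M) *ᵥ fun l => u (blockIdx h a l)) j else 0 := fun j => by
    rw [Matrix.mulVec, dotProduct, sum_blockIdx h]
    simp only [blockDiag_apply]
    rw [Finset.sum_eq_single a]
    · by_cases ha : a ∈ A <;> simp [ha, Matrix.mulVec, dotProduct]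
    · intro b _ hb
      simp [hb.symm]
    · simp
  simp only [e1]
  split_ifs with ha
  · refine (sum_norm_sq_mulVec_le _ _).trans ?_
    have h1 : ‖branch χ (N / M)‖ ^ 2 ≤ 1 := pow_le_one₀ (norm_nonneg _) (norm_branch_le hχ _)
    have : 0 ≤ ∑ l, ‖u (blockIdx h a l)‖ ^ 2 := by positivity
    nlinarith
  · simp only [norm_zero, ne_eq, OfNat.ofNat_ne_zero, not_false_eq_true, zero_pow,
      Finset.sum_const_zero]
    positivity

lemma norm_bakerMap_le (h : M * (N / M) = N) (A : Finset (Fin M)) {χ : ℝ → ℝ} (hχ : IsCutoff χ) :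
    ‖bakerMap M A χ N‖ ≤ 1 := by
  rw [bakerMap_eq]
  refine (norm_mul_le _ _).trans (mul_le_one₀ ?_ (norm_nonneg _) (norm_blockDiag_le h A hχ))
  rw [Matrix.l2_opNorm_conjTranspose]
  exact norm_fourier_le N

/-- The projections are real and the Fourier matrix is symmetric. This symmetry later turns position
localization into frequency localization. -/
lemma blockDiag_transpose (A : Finset (Fin M)) (χ : ℝ → ℝ) :
    (blockDiag M A χ N)ᵀ = blockDiag M A χ N := by
  have h1 : ∀ a, (proj M N a)ᴴ = (proj M N a)ᵀ := fun a => by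
    ext i j
    simp only [Matrix.conjTranspose_apply, Matrix.transpose_apply, proj]
    split_ifs <;> simp
  have h2 : (branch χ (N / M))ᵀ = branch χ (N / M) := by
    rw [branch, Matrix.transpose_mul, Matrix.transpose_mul, fourier_transpose, cutoffOp,
      Matrix.diagonal_transpose, Matrix.mul_assoc]
  rw [blockDiag, Matrix.transpose_sum]
  refine Finset.sum_congr rfl fun a _ => ?_
  rw [h1, Matrix.transpose_mul, Matrix.transpose_mul, h2, Matrix.transpose_transpose,
    Matrix.mul_assoc]

/-- Conjugation by the Fourier transform transposes the baker's map. -/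
lemma fourier_mul_bakerMap_mul (A : Finset (Fin M)) (χ : ℝ → ℝ) :
    fourier N * bakerMap M A χ N * (fourier N)ᴴ = (bakerMap M A χ N)ᵀ := by
  have h1 : ((fourier N)ᴴ)ᵀ = (fourier N)ᴴ := by
    ext i j
    rw [Matrix.transpose_apply, Matrix.conjTranspose_apply, Matrix.conjTranspose_apply]
    exact congrArg star (congrFun (congrFun (fourier_transpose N) j) i)
  rw [bakerMap_eq, Matrix.transpose_mul, blockDiag_transpose, h1, ← Matrix.mul_assoc,
    fourier_mul_conjTranspose, Matrix.one_mul]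

lemma branch_apply (χ : ℝ → ℝ) {n : ℕ} (j l : Fin n) :
    branch χ n j l = χ ((j : ℕ) / n) * fourier n j l * χ ((l : ℕ) / n) := by
  rw [branch, cutoffOp, Matrix.mul_diagonal, Matrix.diagonal_mul]

lemma bakerMap_apply_blockIdx (h : M * (N / M) = N) (A : Finset (Fin M)) (χ : ℝ → ℝ) (y : Fin N)
    (b : Fin M) (l : Fin (N / M)) : bakerMap M A χ N y (blockIdx h b l) =
      if b ∈ A then ∑ j, star (fourier N (blockIdx h b j) y) * branch χ (N / M) j l else 0 := by
  rw [bakerMap_eq, Matrix.mul_apply, sum_blockIdx h]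
  simp only [blockDiag_apply, Matrix.conjTranspose_apply]
  rw [Finset.sum_eq_single b]
  · by_cases hb : b ∈ A <;> simp [hb]
  · intro a _ ha
    simp [ha]
  · simp

/-- After unimodular factors are removed, the `j`-sum has constant frequency `M * l - y`, so it is
large only when this is close to zero modulo `N`. -/
lemma norm_bakerMap_apply_blockIdx (h : M * (N / M) = N) {A : Finset (Fin M)} (χ : ℝ → ℝ)
    (y : Fin N) {b : Fin M} (hb : b ∈ A) (l : Fin (N / M)) :
    ‖bakerMap M A χ N y (blockIdx h b l)‖ =
      1 / Real.sqrt N * (1 / Real.sqrt (N / M : ℕ)) * |χ ((l : ℕ) / (N / M : ℕ))| *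
        ‖∑ j : Fin (N / M), (χ ((j : ℕ) / (N / M : ℕ)) : ℂ) *
          psi N ((M : ℤ) * (l : ℕ) - (y : ℕ)) ^ (j : ℕ)‖ := by
  have hM : M ≠ 0 := by rintro rfl; exact b.elim0
  rw [bakerMap_apply_blockIdx, if_pos hb]
  have e : ∀ j : Fin (N / M), star (fourier N (blockIdx h b j) y) * branch χ (N / M) j l
      = (((1 / Real.sqrt N : ℝ) : ℂ) * ((1 / Real.sqrt (N / M : ℕ) : ℝ) : ℂ) *
        (χ ((l : ℕ) / (N / M : ℕ)) : ℂ) * psi N (-((b : ℕ) * (N / M : ℕ) * (y : ℕ)))) *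
        ((χ ((j : ℕ) / (N / M : ℕ)) : ℂ) * psi N ((M : ℤ) * (l : ℕ) - (y : ℕ)) ^ (j : ℕ)) :=
    fun j => by
      have e1 : psi (N / M) ((j : ℕ) * (l : ℕ)) = psi N ((j : ℕ) * (l : ℕ) * M) := by
        rw [← psi_mul_left hM, mul_comm (N / M), h]
      have e2 : star (1 / (Real.sqrt N : ℂ)) = 1 / (Real.sqrt N : ℂ) := by simp
      have e3 : (-(((blockIdx h b j : Fin N) : ℕ) * (y : ℕ) : ℤ) + (j : ℕ) * (l : ℕ) * M)
          = -((b : ℕ) * (N / M : ℕ) * (y : ℕ)) + ((M : ℤ) * (l : ℕ) - (y : ℕ)) * (j : ℕ) := by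
        simp only [blockIdx]; push_cast; ring
      rw [branch_apply, fourier_apply, fourier_apply, e1, star_mul', ← psi_neg, e2, psi_pow]
      have e4 := congrArg (psi N) e3
      rw [psi_add, psi_add] at e4
      push_cast at e4 ⊢
      linear_combination (1 / (Real.sqrt N : ℂ)) * (1 / (Real.sqrt (N / M : ℕ) : ℂ)) *
        (χ ((l : ℕ) / (N / M : ℕ)) : ℂ) * (χ ((j : ℕ) / (N / M : ℕ)) : ℂ) * e4
  simp only [e]
  rw [← Finset.mul_sum, norm_mul, norm_mul, norm_mul, norm_mul, norm_psi, mul_one,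
    Complex.norm_real, Complex.norm_real, Complex.norm_real, Real.norm_of_nonneg (by positivity),
    Real.norm_of_nonneg (by positivity), Real.norm_eq_abs]

/-- The margin keeps `M * l` away from `0` and `N`. Otherwise `y` near one end and `M * l` near the
other would be neighbours on the circle. -/
lemma exists_cutoff_margin {χ : ℝ → ℝ} (hχ : IsCutoff χ) :
    ∃ c : ℝ, 0 < c ∧ ∀ x, χ x ≠ 0 → c ≤ x ∧ x ≤ 1 - c := by
  obtain ⟨c, hc, h⟩ := hχ.compactSupport.isCompact.exists_forall_le' (f := fun x : ℝ => min x (1 - x))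
    (a := 0) (by fun_prop) fun x hx => by
      have := hχ.support_subset hx
      exact lt_min this.1 (by linarith [this.2])
  refine ⟨c, hc, fun x hx => ?_⟩
  have := h x (subset_tsupport _ hx)
  rw [le_min_iff] at this
  exact ⟨this.1, by linarith [this.2]⟩

/-- The kernel of the baker's map is negligible away from the graph of the expanding map. -/
lemma exists_norm_bakerMap_apply_le {χ : ℝ → ℝ} (hχ : IsCutoff χ) (M : ℕ) (A : Finset (Fin M)) :
    ∃ c : ℝ, 0 < c ∧ ∀ L : ℕ, ∃ C : ℝ, 0 ≤ C ∧ ∀ (N : ℕ) (h : M * (N / M) = N) (w : ℝ), 0 < w →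
      w ≤ c * N → ∀ (y : Fin N) (b : Fin M) (l : Fin (N / M)),
        ¬ (b ∈ A ∧ |((y : ℕ) : ℝ) - M * (l : ℕ)| ≤ w) →
          ‖bakerMap M A χ N y (blockIdx h b l)‖ ≤ C / w ^ L := by
  obtain ⟨c, hc, hmargin⟩ := exists_cutoff_margin hχ
  refine ⟨c, hc, fun L => ?_⟩
  obtain ⟨C, hC0, hC⟩ := exists_norm_sum_cutoff_le hχ L
  refine ⟨C * M ^ L, by positivity, fun N h w hw hwc y b l hgood => ?_⟩
  have hpos : 0 ≤ C * M ^ L / w ^ L := by positivity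
  by_cases hb : b ∈ A
  swap
  · rw [bakerMap_apply_blockIdx, if_neg hb, norm_zero]; exact hpos
  by_cases hl : χ ((l : ℕ) / (N / M : ℕ)) = 0
  · rw [norm_bakerMap_apply_blockIdx h χ y hb, hl]; simpa using hpos
  have hfar : w < |((y : ℕ) : ℝ) - M * (l : ℕ)| := by
    by_contra! h'; exact hgood ⟨hb, h'⟩
  have hn : 0 < N / M := l.pos
  have hM : 0 < M := b.pos
  have hN : 0 < N := y.pos
  have hn' : (0 : ℝ) < (N / M : ℕ) := by exact_mod_cast hn
  have hM' : (1 : ℝ) ≤ M := by exact_mod_cast hM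
  have hN' : (0 : ℝ) < N := by exact_mod_cast hN
  have hNeq : (M : ℝ) * (N / M : ℕ) = N := by exact_mod_cast h
  obtain ⟨hl1, hl2⟩ := hmargin _ hl
  rw [le_div_iff₀ hn'] at hl1
  rw [div_le_iff₀ hn'] at hl2
  have hMl1 : c * N ≤ M * (l : ℕ) := by rw [← hNeq]; nlinarith
  have hMl2 : (M : ℝ) * (l : ℕ) ≤ N - c * N := by rw [← hNeq]; nlinarith
  have hy : ((y : ℕ) : ℝ) ≤ N := by exact_mod_cast y.2.le
  set z := psi N ((M : ℤ) * (l : ℕ) - (y : ℕ)) with hz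
  have hz1 : 4 * w / N ≤ ‖z - 1‖ := by
    refine le_norm_psi_sub_one hN hw.le ?_ ?_
    · push_cast; rw [abs_sub_comm]; exact hfar.le
    · push_cast
      have : (0 : ℝ) ≤ (y : ℕ) := Nat.cast_nonneg _
      rw [abs_le]; constructor <;> linarith
  have hsum := hC (N / M) hn z (norm_psi _ _)
  have hz2 : w / M ≤ (N / M : ℕ) * ‖z - 1‖ := by
    calc w / M ≤ 4 * w / M := by gcongr; linarith
      _ = (N / M : ℕ) * (4 * w / N) := by rw [← hNeq]; field_simp
      _ ≤ _ := by gcongr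
  rw [norm_bakerMap_apply_blockIdx h χ y hb]
  set S := ‖∑ j : Fin (N / M), (χ ((j : ℕ) / (N / M : ℕ)) : ℂ) * z ^ (j : ℕ)‖
  have hS : S ≤ C * M ^ L / w ^ L * (N / M : ℕ) := by
    have h1 : (w / M) ^ L * S ≤ C * (N / M : ℕ) := le_trans (by gcongr) hsum
    have h2 : S = (M ^ L / w ^ L) * ((w / M) ^ L * S) := by rw [div_pow]; field_simp
    rw [h2]
    calc _ ≤ (M ^ L / w ^ L) * (C * (N / M : ℕ)) := by gcongr
      _ = _ := by ring
  have hχ1 : |χ ((l : ℕ) / (N / M : ℕ))| ≤ 1 := by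
    have := hχ.mem_Icc ((l : ℕ) / (N / M : ℕ))
    rw [abs_le]; exact ⟨by linarith [this.1], this.2⟩
  have hsq : 1 / Real.sqrt N ≤ 1 / Real.sqrt (N / M : ℕ) := by
    gcongr
    exact Nat.div_le_self _ _
  have hS0 : 0 ≤ S := norm_nonneg _
  calc _ ≤ 1 / Real.sqrt (N / M : ℕ) * (1 / Real.sqrt (N / M : ℕ)) * 1 *
        (C * M ^ L / w ^ L * (N / M : ℕ)) := by gcongr
    _ = C * M ^ L / w ^ L := by
        rw [mul_one, div_mul_div_comm, Real.mul_self_sqrt hn'.le]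
        field_simp

end Structure

end OpenBaker

namespace OpenBaker

open scoped Matrix.Norms.L2Operator

/-! ### Localization near the Cantor set and the eigenvalue inequality. -/

section Propagation

variable {N : ℕ}

/-- The points from which a path of `n` steps along the relation `good` starts. -/
def reach (good : Fin N → Fin N → Prop) : ℕ → Set (Fin N)
  | 0 => Set.univ
  | n + 1 => {x | ∃ y ∈ reach good n, good y x}

/-- A point outside `reach good (n + 1)` enters `reach good n` only through bad entries. Each step
thus costs at most `N * ε`, and the remaining factors are contractions. -/
lemma norm_pow_mul_indicatorOp_compl_le (B : Matrix (Fin N) (Fin N) ℂ) (hB : ‖B‖ ≤ 1)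
    (good : Fin N → Fin N → Prop) {ε : ℝ} (hε : 0 ≤ ε) (h : ∀ y x, ¬ good y x → ‖B y x‖ ≤ ε) (n : ℕ) :
    ‖B ^ n * indicatorOp (reach good n)ᶜ‖ ≤ n * (N * ε) := by
  induction n with
  | zero =>
    have : indicatorOp (reach good 0)ᶜ = (0 : Matrix (Fin N) (Fin N) ℂ) := by
      simp [reach, indicatorOp]
    rw [this]
    simp
  | succ n ih =>
    set P := indicatorOp (reach good n) with hP
    set P' := indicatorOp (reach good n)ᶜ with hP'
    set Q := indicatorOp (reach good (n + 1))ᶜ with hQ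
    have e1 : B ^ (n + 1) * Q = B ^ n * (P * B * Q) + (B ^ n * P') * (B * Q) := by
      have : P + P' = 1 := indicatorOp_add_compl _
      calc B ^ (n + 1) * Q = B ^ n * (P + P') * (B * Q) := by
            rw [this, mul_one, pow_succ, mul_assoc]
        _ = _ := by noncomm_ring
    have h1 : ‖P * B * Q‖ ≤ N * ε := by
      have := norm_le_card_mul_of_forall_norm_le (P * B * Q) hε fun y x => by
        rw [indicatorOp_mul_mul_apply]
        split_ifs with hyx
        · exact h y x fun hg => hyx.2 ⟨y, hyx.1, hg⟩
        · simpa using hε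
      simpa using this
    have h2 : ‖B ^ n‖ ≤ 1 := by
      rcases Nat.eq_zero_or_pos n with rfl | hn
      · rw [pow_zero]; exact norm_one_matrix_le
      · exact (norm_pow_le' B hn).trans (pow_le_one₀ (norm_nonneg _) hB)
    have h3 : ‖B * Q‖ ≤ 1 :=
      (norm_mul_le _ _).trans (mul_le_one₀ hB (norm_nonneg _) (norm_indicatorOp_le _))
    rw [e1]
    calc _ ≤ ‖B ^ n‖ * ‖P * B * Q‖ + ‖B ^ n * P'‖ * ‖B * Q‖ :=
          (norm_add_le _ _).trans (add_le_add (norm_mul_le _ _) (norm_mul_le _ _))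
      _ ≤ 1 * (N * ε) + n * (N * ε) * 1 := by gcongr
      _ = _ := by push_cast; ring

/-- Compressing a matrix along partial injections with bounded weights does not increase its
norm. -/
lemma norm_le_of_partial_injections {n : Type*} [Fintype n] [DecidableEq n] (T T' : Matrix n n ℂ)
    (Y Z : Set n) (f g : n → n) (hf : Set.InjOn f Y) (hg : Set.InjOn g Z) (α β : n → ℂ)
    (hα : ∀ y, ‖α y‖ ≤ 1) (hβ : ∀ x, ‖β x‖ ≤ 1)
    (h : ∀ y ∈ Y, ∀ x ∈ Z, T' y x = α y * T (f y) (g x) * β x)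
    (h0 : ∀ y x, ¬ (y ∈ Y ∧ x ∈ Z) → T' y x = 0) : ‖T'‖ ≤ ‖T‖ := by
  classical
  -- The compressed matrix is `W * T * Vᴴ`, where `W` and `V` encode the weighted partial
  -- injections. Injectivity makes `W * Wᴴ` diagonal, with entries at most one.
  have key : ∀ (Y : Set n) (f : n → n) (α : n → ℂ), Set.InjOn f Y → (∀ y, ‖α y‖ ≤ 1) →
      ‖(Matrix.of fun y c => if y ∈ Y ∧ c = f y then α y else 0 : Matrix n n ℂ)‖ ≤ 1 := by
    intro Y f α hf hα
    refine norm_le_one_of_mul_conjTranspose_self _ ?_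
    have : (Matrix.of fun y c => if y ∈ Y ∧ c = f y then α y else 0 : Matrix n n ℂ) *
        (Matrix.of fun y c => if y ∈ Y ∧ c = f y then α y else 0 : Matrix n n ℂ)ᴴ =
        Matrix.diagonal fun y => if y ∈ Y then α y * star (α y) else 0 := by
      ext y y'
      rw [Matrix.mul_apply]
      simp only [Matrix.conjTranspose_apply, Matrix.of_apply]
      rw [Finset.sum_eq_single (f y)]
      · by_cases hyy : y = y'
        · subst hyy
          by_cases hy : y ∈ Y <;> simp [hy]
        · rw [Matrix.diagonal_apply_ne _ hyy]
          by_cases hy : y ∈ Y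
          · rw [if_neg (c := y' ∈ Y ∧ f y = f y') fun h' => hyy (hf hy h'.1 h'.2)]
            simp
          · simp [hy]
      · intro c _ hc
        simp [hc]
      · simp
    rw [this]
    refine norm_diagonal_le_one fun y => ?_
    split_ifs
    · rw [norm_mul, norm_star]; exact mul_le_one₀ (hα y) (norm_nonneg _) (hα y)
    · simp
  have h1 := key Y f α hf hα
  have h2 := key Z g (fun x => star (β x)) hg fun x => by rw [norm_star]; exact hβ x
  set W := (Matrix.of fun y c => if y ∈ Y ∧ c = f y then α y else 0 : Matrix n n ℂ) with hW
  set V := (Matrix.of fun y c => if y ∈ Z ∧ c = g y then star (β y) else 0 : Matrix n n ℂ) with hV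
  have e : T' = W * T * Vᴴ := by
    ext y x
    rw [Matrix.mul_apply]
    simp only [Matrix.mul_apply, Matrix.conjTranspose_apply, hW, hV, Matrix.of_apply]
    by_cases hyx : y ∈ Y ∧ x ∈ Z
    · simp [hyx.1, hyx.2, h y hyx.1 x hyx.2, apply_ite, ite_mul]
    · rw [h0 y x hyx]
      by_cases hy : y ∈ Y
      · have hx : x ∉ Z := fun hx => hyx ⟨hy, hx⟩
        simp [hx]
      · simp [hy]
  rw [e]
  calc _ ≤ ‖W * T‖ * ‖Vᴴ‖ := norm_mul_le _ _
    _ ≤ ‖W‖ * ‖T‖ * ‖V‖ := by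
        rw [Matrix.l2_opNorm_conjTranspose]
        gcongr
        exact norm_mul_le _ _
    _ ≤ 1 * ‖T‖ * 1 := by gcongr
    _ = ‖T‖ := by ring

lemma indicatorOp_eq_sum {ι : Type*} [DecidableEq ι] (X : Set (Fin N)) (s : Fin N → ι)
    (S : Finset ι) (hs : ∀ x ∈ X, s x ∈ S) :
    indicatorOp X = ∑ i ∈ S, indicatorOp {x ∈ X | s x = i} := by
  simp only [indicatorOp]
  ext y x
  rw [Matrix.sum_apply]
  by_cases hyx : y = x
  · subst hyx
    simp only [Matrix.diagonal_apply_eq]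
    by_cases hy : y ∈ X
    · rw [Finset.sum_eq_single (s y)]
      · simp [hy]
      · intro i _ hi
        simp [hi.symm]
      · intro h; exact absurd (hs y hy) h
    · simp [hy]
  · simp [hyx]

variable {M : ℕ} {A : Finset (Fin M)}

/-- The norm of the Fourier transform between sets covered by translates of the Cantor set. -/
lemma norm_indicatorOp_fourier_le {k S : ℕ} (X : Set (Fin (M ^ k)))
    (hX : ∀ x ∈ X, ∃ c ∈ cantorNat M A k, |((x : ℕ) : ℤ) - c| ≤ S) :
    ‖indicatorOp X * fourier (M ^ k) * indicatorOp X‖ ≤ (2 * S + 1) ^ 2 * cantorNorm M A k := by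
  classical
  have hX' : ∀ x : Fin (M ^ k), ∃ c : Fin (M ^ k), x ∈ X →
      (c : ℕ) ∈ cantorNat M A k ∧ |((x : ℕ) : ℤ) - (c : ℕ)| ≤ S := fun x => by
    by_cases hx : x ∈ X
    · obtain ⟨c, hc, h⟩ := hX x hx
      exact ⟨⟨c, cantorNat_lt hc⟩, fun _ => ⟨hc, h⟩⟩
    · exact ⟨x, fun h => absurd h hx⟩
  choose f hf using hX'
  -- On a piece of constant offset `s` the chosen Cantor point determines `x`. There are `2 * S + 1`
  -- offsets on each side of the transform.
  set s : Fin (M ^ k) → ℤ := fun x => ((x : ℕ) : ℤ) - (f x : ℕ) with hs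
  have hsum := indicatorOp_eq_sum X s (Finset.Icc (-(S : ℤ)) S) fun x hx => by
    rw [Finset.mem_Icc, ← abs_le]; exact (hf x hx).2
  have hpiece : ∀ i j : ℤ, ‖indicatorOp {x ∈ X | s x = i} * fourier (M ^ k) *
      indicatorOp {x ∈ X | s x = j}‖ ≤ cantorNorm M A k := fun i j => by
    have hinj : ∀ i, Set.InjOn f {x ∈ X | s x = i} := fun i x hx y hy h => by
      have h1 : s x = s y := hx.2.trans hy.2.symm
      simp only [hs, h] at h1
      ext; omega
    rw [cantorNorm_eq]
    -- Expanding `(f y + i) * (f x + j)`, the offsets contribute unimodular factors depending on `y`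
    -- alone or on `x` alone.
    refine norm_le_of_partial_injections _ _ {x ∈ X | s x = i} {x ∈ X | s x = j} f f (hinj i)
      (hinj j) (fun y => psi (M ^ k) (j * (f y : ℕ) + i * j)) (fun x => psi (M ^ k) (i * (f x : ℕ)))
      (fun _ => (norm_psi _ _).le) (fun _ => (norm_psi _ _).le) (fun y hy x hx => ?_)
      fun y x h => ?_
    · rw [indicatorOp_mul_mul_apply, if_pos ⟨hy, hx⟩, indicatorOp_mul_mul_apply, if_pos
        ⟨(mem_cantorSet_iff _).2 (hf y hy.1).1, (mem_cantorSet_iff _).2 (hf x hx.1).1⟩,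
        fourier_apply, fourier_apply]
      have e1 : ((y : ℕ) : ℤ) = (f y : ℕ) + i := by have := hy.2; simp only [hs] at this; omega
      have e2 : ((x : ℕ) : ℤ) = (f x : ℕ) + j := by have := hx.2; simp only [hs] at this; omega
      rw [e1, e2, show (((f y : ℕ) + i) * ((f x : ℕ) + j) : ℤ)
        = (j * (f y : ℕ) + i * j) + (f y : ℕ) * (f x : ℕ) + i * (f x : ℕ) by ring, psi_add, psi_add]
      ring
    · rw [indicatorOp_mul_mul_apply, if_neg h]
  have e : indicatorOp X * fourier (M ^ k) * indicatorOp X =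
      ∑ i ∈ Finset.Icc (-(S : ℤ)) S, ∑ j ∈ Finset.Icc (-(S : ℤ)) S,
        indicatorOp {x ∈ X | s x = i} * fourier (M ^ k) * indicatorOp {x ∈ X | s x = j} := by
    conv_lhs => rw [hsum, Finset.sum_mul, Finset.sum_mul]
    simp only [Finset.mul_sum]
  have hcard : ((Finset.Icc (-(S : ℤ)) S).card : ℝ) = 2 * S + 1 := by
    rw [Int.card_Icc, show (S + 1 - -(S : ℤ)).toNat = 2 * S + 1 by omega]
    push_cast; rfl
  rw [e]
  calc _ ≤ ∑ i ∈ Finset.Icc (-(S : ℤ)) S, ∑ j ∈ Finset.Icc (-(S : ℤ)) S, cantorNorm M A k :=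
        (norm_sum_le _ _).trans (Finset.sum_le_sum fun i _ =>
          (norm_sum_le _ _).trans (Finset.sum_le_sum fun j _ => hpiece i j))
    _ = _ := by
        simp only [Finset.sum_const, nsmul_eq_mul, hcard]; ring

/-- Up to an error `w`, the point `x` is mapped to `y` by a branch of the expanding map. -/
def expandsTo (A : Finset (Fin M)) (k w : ℕ) (y x : Fin (M ^ k)) : Prop :=
  ∃ b ∈ A, ∃ l : ℕ, (x : ℕ) = l + b * (M ^ k / M) ∧ |((y : ℕ) : ℤ) - M * l| ≤ w

/-- The branches used along the path are the leading digits of `x`. Going back along the expanding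
map divides errors by `M`, so they do not accumulate. -/
lemma exists_cantorNat_of_mem_reach (hM : 2 ≤ M) {k w n : ℕ} (hn : n ≤ k) {x : Fin (M ^ k)}
    (hx : x ∈ reach (expandsTo A k w) n) :
    ∃ c ∈ cantorNat M A n, |((x : ℕ) : ℤ) - M ^ (k - n) * c| ≤ w + M ^ (k - n) := by
  induction n generalizing x with
  | zero =>
    refine ⟨0, by simp [cantorNat], ?_⟩
    have : ((x : ℕ) : ℤ) < M ^ k := by exact_mod_cast x.2
    simp only [Nat.cast_zero, mul_zero, sub_zero, Nat.abs_cast, Nat.sub_zero]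
    omega
  | succ n ih =>
    obtain ⟨y, hy, b, hb, l, hxl, hyl⟩ := hx
    obtain ⟨c, hc, hcy⟩ := ih (by omega) hy
    refine ⟨(b : ℕ) * M ^ n + c, mem_cantorNat_succ.2 ⟨b, hb, c, hc, rfl⟩, ?_⟩
    have hdiv : M ^ k / M = M ^ (k - (n + 1)) * M ^ n := by
      refine Nat.div_eq_of_eq_mul_left (by omega) ?_
      rw [← pow_add, ← pow_succ, show k - (n + 1) + n + 1 = k by omega]
    have hP : ((M : ℤ) ^ (k - n)) = M * M ^ (k - (n + 1)) := by
      rw [← pow_succ', show k - (n + 1) + 1 = k - n by omega]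
    rw [hP] at hcy
    rw [hdiv] at hxl
    set P : ℤ := (M : ℤ) ^ (k - (n + 1)) with hPdef
    have e : ((x : ℕ) : ℤ) - P * (((b : ℕ) * M ^ n + c : ℕ) : ℤ) = l - P * c := by
      rw [hxl, hPdef]; push_cast; ring
    rw [e]
    have hM' : (2 : ℤ) ≤ M := by exact_mod_cast hM
    -- The two errors add up to `2 * w + M * P`, which is at most `M * (w + P)` because `M ≥ 2`.
    have h1 : (M : ℤ) * |(l : ℤ) - P * c| ≤ M * (w + P) := by
      have h2 : (M : ℤ) * |(l : ℤ) - P * c| = |(M : ℤ) * l - M * P * c| := by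
        rw [← Nat.abs_cast M, ← abs_mul, Nat.abs_cast]; congr 1; ring
      have h3 := abs_sub_le ((M : ℤ) * l) ((y : ℕ) : ℤ) (M * P * c)
      rw [abs_sub_comm ((M : ℤ) * l) ((y : ℕ) : ℤ)] at h3
      have : (0 : ℤ) ≤ w := by positivity
      nlinarith
    exact le_of_mul_le_mul_left h1 (by omega)

lemma exists_cantorNat_near_of_mem_reach (hM : 2 ≤ M) (hA : A.Nonempty) {k m : ℕ} (hm : m ≤ k)
    {x : Fin (M ^ k)} (hx : x ∈ reach (expandsTo A k (M ^ m)) (k - m)) :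
    ∃ c ∈ cantorNat M A k, |((x : ℕ) : ℤ) - c| ≤ (3 * M ^ m : ℕ) := by
  obtain ⟨c, hc, h⟩ := exists_cantorNat_of_mem_reach hM (Nat.sub_le k m) hx
  -- The `m` low digits are filled in arbitrarily, at a cost below `M ^ m`.
  obtain ⟨d, hd⟩ := cantorNat_nonempty hA m
  have h1 := mem_cantorNat_add.2 ⟨c, hc, d, hd, rfl⟩
  rw [show m + (k - m) = k by omega] at h1
  rw [show k - (k - m) = m by omega] at h
  refine ⟨_, h1, ?_⟩
  have hd' : (d : ℤ) < M ^ m := by exact_mod_cast cantorNat_lt hd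
  push_cast at h ⊢
  rw [abs_le] at h ⊢
  constructor <;> linarith [h.1, h.2, (Nat.cast_nonneg d : (0 : ℤ) ≤ d)]

/-- All columns of `V` are one eigenvector; a square matrix keeps the estimates inside a single
normed algebra. -/
lemma exists_matrix_of_mem_spectrum {B : Matrix (Fin N) (Fin N) ℂ} {z : ℂ} (hz : z ∈ spectrum ℂ B) :
    ∃ V : Matrix (Fin N) (Fin N) ℂ, V ≠ 0 ∧ B * V = z • V := by
  rw [spectrum.mem_iff, Matrix.isUnit_iff_isUnit_det, isUnit_iff_ne_zero, not_not] at hz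
  obtain ⟨v, hv, h⟩ := Matrix.exists_mulVec_eq_zero_iff.2 hz
  obtain ⟨i, hi⟩ := Function.ne_iff.1 hv
  refine ⟨Matrix.of fun i _ => v i, fun h0 => hi (congrFun (congrFun h0 i) i), ?_⟩
  ext a b
  have h2 := congrFun h a
  rw [Matrix.sub_mulVec, Pi.sub_apply, Pi.zero_apply, sub_eq_zero, Algebra.algebraMap_eq_smul_one,
    Matrix.smul_mulVec, Matrix.one_mulVec] at h2
  rw [Matrix.mul_apply]
  exact h2.symm

/-- Localization of eigenfunctions in position and frequency bounds the eigenvalues. -/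
lemma norm_pow_mul_self_le_of_mem_spectrum {F B : Matrix (Fin N) (Fin N) ℂ}
    (hF1 : Fᴴ * F = 1) (hF2 : ‖F‖ ≤ 1) (hB : ‖B‖ ≤ 1) (hFB : F * B * Fᴴ = Bᵀ) (X : Set (Fin N))
    {n : ℕ} (hn : 0 < n) {q η : ℝ} (hq : ‖indicatorOp X * F * indicatorOp X‖ ≤ q)
    (hη : ‖B ^ n * indicatorOp Xᶜ‖ ≤ η) {z : ℂ} (hz : z ∈ spectrum ℂ B) :
    ‖z‖ ^ n * ‖z‖ ^ n ≤ q * ‖z‖ ^ n + 2 * η ∧ ‖z‖ ≤ 1 := by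
  obtain ⟨V, hV, hBV⟩ := exists_matrix_of_mem_spectrum hz
  have hVpos : 0 < ‖V‖ := norm_pos_iff.2 hV
  have hz1 : ‖z‖ ≤ 1 := by
    have h1 := norm_mul_le B V
    rw [hBV, norm_smul] at h1
    have h2 : ‖z‖ * ‖V‖ ≤ 1 * ‖V‖ := h1.trans (by gcongr)
    exact le_of_mul_le_mul_right h2 hVpos
  refine ⟨?_, hz1⟩
  have hBn : ∀ n, B ^ n * V = z ^ n • V := fun n => by
    induction n with
    | zero => simp
    | succ n ih => rw [pow_succ, mul_assoc, hBV, Matrix.mul_smul, ih, smul_smul, pow_succ, mul_comm]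
  have hsemi : F * B ^ n = Bᵀ ^ n * F := by
    have : SemiconjBy F B Bᵀ := by
      rw [SemiconjBy, ← hFB, mul_assoc (F * B), hF1, mul_one]
    exact this.pow_right n
  set P := indicatorOp X with hP
  set P' := indicatorOp Xᶜ with hP'
  set R := B ^ n * P' with hR
  have hRt : P' * Bᵀ ^ n = Rᵀ := by
    rw [hR, Matrix.transpose_mul, Matrix.transpose_pow, hP', indicatorOp_transpose]
  have hPP : P + P' = 1 := indicatorOp_add_compl X
  -- Frequency localization: outside `X`, the transform of the range of `B ^ n` is governed by the
  -- transposed remainder.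
  have hFBn : F * B ^ n = P * F * B ^ n + Rᵀ * F := by
    calc F * B ^ n = (P + P') * (F * B ^ n) := by rw [hPP, one_mul]
      _ = P * F * B ^ n + P' * (F * B ^ n) := by rw [add_mul, mul_assoc P]
      _ = _ := by rw [hsemi, ← mul_assoc P', hRt]
  -- Between the two powers stands `Fᴴ * F = 1`, cut to `X` in position on the left and in frequency
  -- on the right.
  have e1 : B ^ n * B ^ n = B ^ n * (P * Fᴴ * P) * F * B ^ n + B ^ n * P * Fᴴ * Rᵀ * F + R * B ^ n := by
    calc B ^ n * B ^ n = B ^ n * (P + P') * B ^ n := by rw [hPP, mul_one]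
      _ = B ^ n * P * (Fᴴ * F) * B ^ n + R * B ^ n := by rw [hF1, hR]; noncomm_ring
      _ = B ^ n * P * Fᴴ * (F * B ^ n) + R * B ^ n := by noncomm_ring
      _ = B ^ n * P * Fᴴ * (P * F * B ^ n + Rᵀ * F) + R * B ^ n := by rw [← hFBn]
      _ = _ := by noncomm_ring
  have e2 : (z ^ n * z ^ n) • V = z ^ n • (B ^ n * ((P * Fᴴ * P) * (F * V)))
      + B ^ n * (P * (Fᴴ * (Rᵀ * (F * V)))) + z ^ n • (R * V) := by
    have h1 := congrArg (· * V) e1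
    simp only [add_mul, mul_assoc, hBn, Matrix.mul_smul] at h1
    rw [smul_smul] at h1
    simpa only [mul_assoc] using h1
  have hBn1 : ‖B ^ n‖ ≤ 1 := (norm_pow_le' B hn).trans (pow_le_one₀ (norm_nonneg _) hB)
  have hPn : ‖P‖ ≤ 1 := norm_indicatorOp_le X
  have hF3 : ‖Fᴴ‖ ≤ 1 := by rw [Matrix.l2_opNorm_conjTranspose]; exact hF2
  have hq' : ‖P * Fᴴ * P‖ ≤ q := by
    rw [← Matrix.l2_opNorm_conjTranspose]
    simpa [Matrix.conjTranspose_mul, hP, indicatorOp_conjTranspose, Matrix.mul_assoc] using hq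
  have hRt' : ‖Rᵀ‖ ≤ η := norm_transpose_le_of_forall R hη
  have hq0 : 0 ≤ q := (norm_nonneg _).trans hq
  have hη0 : 0 ≤ η := (norm_nonneg _).trans hη
  have hFV : ‖F * V‖ ≤ ‖V‖ := by
    calc _ ≤ ‖F‖ * ‖V‖ := norm_mul_le _ _
      _ ≤ 1 * ‖V‖ := by gcongr
      _ = ‖V‖ := one_mul _
  have t1 : ‖B ^ n * ((P * Fᴴ * P) * (F * V))‖ ≤ q * ‖V‖ := by
    calc _ ≤ ‖B ^ n‖ * (‖P * Fᴴ * P‖ * ‖F * V‖) :=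
          (norm_mul_le _ _).trans (by gcongr; exact norm_mul_le _ _)
      _ ≤ 1 * (q * ‖V‖) := by gcongr
      _ = _ := one_mul _
  have t2 : ‖B ^ n * (P * (Fᴴ * (Rᵀ * (F * V))))‖ ≤ η * ‖V‖ := by
    have s1 : ‖Rᵀ * (F * V)‖ ≤ η * ‖V‖ := (norm_mul_le _ _).trans (by gcongr)
    have step : ∀ {U W : Matrix (Fin N) (Fin N) ℂ}, ‖U‖ ≤ 1 → ‖W‖ ≤ η * ‖V‖ → ‖U * W‖ ≤ η * ‖V‖ :=
      fun hU hW => (norm_mul_le _ _).trans ((mul_le_of_le_one_left (norm_nonneg _) hU).trans hW)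
    exact step hBn1 (step hPn (step hF3 s1))
  have t3 : ‖R * V‖ ≤ η * ‖V‖ := (norm_mul_le _ _).trans (by gcongr)
  have hzn : ‖z‖ ^ n ≤ 1 := pow_le_one₀ (norm_nonneg _) hz1
  have h5 : ‖z‖ ^ n * ‖z‖ ^ n * ‖V‖ ≤ (q * ‖z‖ ^ n + 2 * η) * ‖V‖ := by
    calc ‖z‖ ^ n * ‖z‖ ^ n * ‖V‖ = ‖(z ^ n * z ^ n) • V‖ := by
          rw [norm_smul, norm_mul, norm_pow]
      _ ≤ ‖z‖ ^ n * (q * ‖V‖) + η * ‖V‖ + ‖z‖ ^ n * (η * ‖V‖) := by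
          rw [e2]
          refine (norm_add_le _ _).trans (add_le_add ((norm_add_le _ _).trans
            (add_le_add ?_ t2)) ?_)
          · rw [norm_smul, norm_pow]; gcongr
          · rw [norm_smul, norm_pow]; gcongr
      _ ≤ ‖z‖ ^ n * (q * ‖V‖) + η * ‖V‖ + 1 * (η * ‖V‖) := by gcongr
      _ = _ := by ring
  exact le_of_mul_le_mul_right h5 hVpos

lemma mul_pow_div_self {k : ℕ} (hk : 0 < k) : M * (M ^ k / M) = M ^ k :=
  Nat.mul_div_cancel' (dvd_pow_self M hk.ne')

/-- The spectral bound at fixed `k`, with localization scale `M ^ m`. -/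
lemma exists_spectrum_bakerMap_bound (hM : 2 ≤ M) (hA : A.Nonempty) {χ : ℝ → ℝ} (hχ : IsCutoff χ) :
    ∃ c : ℝ, 0 < c ∧ ∀ L : ℕ, ∃ C : ℝ, 0 ≤ C ∧ ∀ k m : ℕ, m < k → (M : ℝ) ^ m ≤ c * M ^ k →
      ∀ z ∈ spectrum ℂ (bakerMap M A χ (M ^ k)), ‖z‖ ≤ 1 ∧
        ‖z‖ ^ (k - m) * ‖z‖ ^ (k - m) ≤ 49 * M ^ (2 * m) * cantorNorm M A k * ‖z‖ ^ (k - m) +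
          2 * (k * (M ^ k * (C / (M ^ m) ^ L))) := by
  obtain ⟨c, hc, hker⟩ := exists_norm_bakerMap_apply_le hχ M A
  refine ⟨c, hc, fun L => ?_⟩
  obtain ⟨C, hC0, hC⟩ := hker L
  refine ⟨C, hC0, fun k m hmk hmc z hz => ?_⟩
  have hM' : (0 : ℝ) < M := by exact_mod_cast (by omega : 0 < M)
  have hdiv := mul_pow_div_self (M := M) (k := k) (by omega)
  have hε : (0 : ℝ) ≤ C / (M ^ m) ^ L := by positivity
  have hB := norm_bakerMap_le hdiv A hχ
  have hprop := norm_pow_mul_indicatorOp_compl_le (bakerMap M A χ (M ^ k)) hB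
    (expandsTo A k (M ^ m)) hε (fun y x hyx => by
      obtain ⟨b, l, rfl⟩ := exists_blockIdx hdiv x
      refine hC (M ^ k) hdiv (M ^ m) (by positivity) (by push_cast; exact hmc) y b l fun h => hyx ?_
      exact ⟨b, h.1, l, rfl, by exact_mod_cast h.2⟩) (k - m)
  have hη : ‖bakerMap M A χ (M ^ k) ^ (k - m) *
      indicatorOp (reach (expandsTo A k (M ^ m)) (k - m))ᶜ‖ ≤ k * (M ^ k * (C / (M ^ m) ^ L)) := by
    refine hprop.trans ?_
    push_cast
    gcongr
    exact_mod_cast Nat.sub_le k m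
  have hq : ‖indicatorOp (reach (expandsTo A k (M ^ m)) (k - m)) * fourier (M ^ k) *
      indicatorOp (reach (expandsTo A k (M ^ m)) (k - m))‖
      ≤ 49 * M ^ (2 * m) * cantorNorm M A k := by
    refine (norm_indicatorOp_fourier_le _ fun x hx =>
      exists_cantorNat_near_of_mem_reach hM hA hmk.le hx).trans ?_
    have h1 : (1 : ℝ) ≤ M ^ m := one_le_pow₀ (by exact_mod_cast (by omega : 1 ≤ M))
    -- The constant is `7 ^ 2`, from `6 * M ^ m + 1 ≤ 7 * M ^ m`.
    have h2 : (2 * ((3 * M ^ m : ℕ) : ℝ) + 1) ^ 2 ≤ 49 * M ^ (2 * m) := by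
      rw [mul_comm 2 m, pow_mul]
      push_cast
      nlinarith
    exact mul_le_mul_of_nonneg_right h2 (cantorNorm_nonneg _ _ _)
  have := norm_pow_mul_self_le_of_mem_spectrum (fourier_conjTranspose_mul_self _)
    (norm_fourier_le _) hB (fourier_mul_bakerMap_mul A χ) _ (by omega) hq hη hz
  exact ⟨this.2, this.1⟩

end Propagation

end OpenBaker

namespace OpenBaker

/-! ### Choice of scales and passage to the limit. -/

section Asymptotics

variable {M : ℕ} {A : Finset (Fin M)}

lemma eventually_cantorNorm_le (hM : 2 ≤ M) (hA : A.Nonempty) {β γ : ℝ}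
    (hβ : Tendsto (fun k : ℕ => -(Real.log (cantorNorm M A k) / ((k : ℝ) * Real.log (M : ℝ))))
      atTop (𝓝 β)) (hγ : γ < β) : ∀ᶠ k : ℕ in atTop, cantorNorm M A k ≤ (M : ℝ) ^ (-γ * k) := by
  filter_upwards [hβ.eventually_const_lt hγ, eventually_gt_atTop 0] with k hk hk0
  have hM' : (1 : ℝ) < M := by exact_mod_cast (by omega : 1 < M)
  have hlog := Real.log_pos hM'
  have hk0' : (0 : ℝ) < k := by exact_mod_cast hk0
  have hpos := cantorNorm_pos (by omega) hA k
  rw [lt_neg, div_lt_iff₀ (by positivity)] at hk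
  rw [Real.rpow_def_of_pos (by positivity), ← Real.log_le_iff_le_exp hpos]
  linarith

lemma eventually_spectrum_bakerMap_le (hM : 2 ≤ M) (hA : A.Nonempty) {χ : ℝ → ℝ}
    (hχ : IsCutoff χ) {β ε : ℝ} (hε : 0 < ε) (hεβ : ε < β)
    (hβ : Tendsto (fun k : ℕ => -(Real.log (cantorNorm M A k) / ((k : ℝ) * Real.log (M : ℝ))))
      atTop (𝓝 β)) : ∀ᶠ k : ℕ in atTop, ∀ z ∈ spectrum ℂ (bakerMap M A χ (M ^ k)),
        ‖z‖ ≤ (M : ℝ) ^ (-(β - ε)) := by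
  obtain ⟨c, hc, hbound⟩ := exists_spectrum_bakerMap_bound hM hA hχ
  -- With `m = k / Q`, the bound `Q > 8 / ε` makes the loss `M ^ (2 * m)` at most `M ^ (ε k / 4)`.
  -- With decay order `Q * P`, the bound `P > 2 + 2 β` makes the remainder `O(M ^ (-2 β k))`.
  obtain ⟨Q, hQ⟩ := exists_nat_gt (max 2 (8 / ε))
  obtain ⟨P, hP⟩ := exists_nat_gt (2 + 2 * β)
  obtain ⟨C, hC0, hC⟩ := hbound (Q * P)
  have hQ2 : 2 < Q := by exact_mod_cast (le_max_left _ _).trans_lt hQ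
  have hQ0 : (0 : ℝ) < Q := by exact_mod_cast (by omega : 0 < Q)
  have hQε : 8 / ε < Q := (le_max_right _ _).trans_lt hQ
  have hM1 : (1 : ℝ) < M := by exact_mod_cast (by omega : 1 < M)
  have hM0 : (0 : ℝ) < M := by linarith
  have hMle : (1 : ℝ) ≤ M := hM1.le
  have hgrow : Tendsto (fun k : ℕ => (M : ℝ) ^ (k / 2)) atTop atTop :=
    (tendsto_pow_atTop_atTop_of_one_lt hM1).comp (Nat.tendsto_div_const_atTop two_ne_zero)
  have hgrow2 : Tendsto (fun k : ℕ => (M : ℝ) ^ (ε / 2 * k)) atTop atTop := by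
    have : (fun k : ℕ => (M : ℝ) ^ (ε / 2 * k)) = fun k : ℕ => ((M : ℝ) ^ (ε / 2)) ^ k := by
      ext k
      rw [Real.rpow_mul_natCast hM0.le]
    rw [this]
    exact tendsto_pow_atTop_atTop_of_one_lt (Real.one_lt_rpow hM1 (by positivity))
  filter_upwards [eventually_cantorNorm_le hM hA hβ (show β - ε / 4 < β by linarith),
    hgrow.eventually_ge_atTop (1 / c), hgrow2.eventually_gt_atTop (49 + 2 * (C * M ^ (Q * P))),
    eventually_gt_atTop 0] with k hr hk1 hk2 hk0 z hz
  by_contra! hlt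
  set m := k / Q with hm
  have hm2 : m ≤ k / 2 := Nat.div_le_div_left hQ2.le two_pos
  have hmk : m < k := Nat.div_lt_self hk0 (by omega)
  have hmQ : m * Q ≤ k := Nat.div_mul_le_self k Q
  have hmQ2 : k ≤ m * Q + Q := by
    have := Nat.div_add_mod k Q
    have := Nat.mod_lt k (by omega : Q > 0)
    rw [hm, mul_comm]
    omega
  have hmc : (M : ℝ) ^ m ≤ c * M ^ k := by
    have h1 : 1 ≤ c * (M : ℝ) ^ (k / 2) := by
      rw [div_le_iff₀ hc] at hk1; linarith
    calc (M : ℝ) ^ m ≤ M ^ (k - k / 2) := pow_le_pow_right₀ hMle (by omega)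
      _ ≤ c * (M : ℝ) ^ (k / 2) * M ^ (k - k / 2) := le_mul_of_one_le_left (by positivity) h1
      _ = c * M ^ k := by rw [mul_assoc, ← pow_add, show k / 2 + (k - k / 2) = k by omega]
  obtain ⟨hz1, hzb⟩ := hC k m hmk hmc z hz
  have hk' : (0 : ℝ) ≤ k := Nat.cast_nonneg k
  have hr0 := cantorNorm_nonneg M A k
  set t := ‖z‖ ^ (k - m) with ht
  have ht_low : (M : ℝ) ^ (-(β - ε) * k) ≤ t := by
    rw [Real.rpow_mul_natCast hM0.le]
    -- The base is at most one because `ε < β`.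
    calc ((M : ℝ) ^ (-(β - ε))) ^ k ≤ ((M : ℝ) ^ (-(β - ε))) ^ (k - m) :=
          pow_le_pow_of_le_one (by positivity)
            (Real.rpow_le_one_of_one_le_of_nonpos hMle (by linarith)) (Nat.sub_le k m)
      _ ≤ t := pow_le_pow_left₀ (by positivity) hlt.le _
  have ht0 : 0 < t := lt_of_lt_of_le (by positivity) ht_low
  -- The factor `M ^ (Q * P)` pays for the rounding in `m = k / Q`.
  set K : ℝ := C * M ^ (Q * P) with hK
  have hK0 : 0 ≤ K := by positivity
  have hrem : (k : ℝ) * (M ^ k * (C / (M ^ m) ^ (Q * P))) ≤ K * (M : ℝ) ^ (-(2 * β) * k) := by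
    have h1 : (k : ℝ) ≤ M ^ k := by
      exact_mod_cast (Nat.lt_pow_self (by omega : 1 < M)).le
    have h2 : (M : ℝ) ^ (k * P) ≤ M ^ (Q * P) * (M ^ m) ^ (Q * P) := by
      rw [← pow_mul, ← pow_add]
      refine pow_le_pow_right₀ hMle ?_
      calc k * P ≤ (m * Q + Q) * P := Nat.mul_le_mul_right _ hmQ2
        _ = _ := by ring
    have h3 : C / ((M : ℝ) ^ m) ^ (Q * P) ≤ K / M ^ (k * P) := by
      rw [div_le_div_iff₀ (by positivity) (by positivity), hK, mul_assoc]
      gcongr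
    calc (k : ℝ) * (M ^ k * (C / (M ^ m) ^ (Q * P))) ≤ M ^ k * (M ^ k * (K / M ^ (k * P))) := by
          gcongr
      _ = K * (M : ℝ) ^ ((2 - P : ℝ) * k) := by
          rw [sub_mul, Real.rpow_sub hM0, ← Nat.cast_mul, mul_comm P k, Real.rpow_natCast,
            two_mul, Real.rpow_add hM0, Real.rpow_natCast]
          ring
      _ ≤ _ := by
          gcongr
          linarith
  have hq : 49 * (M : ℝ) ^ (2 * m) * cantorNorm M A k ≤ 49 * (M : ℝ) ^ (-(β - ε / 2) * k) := by
    have h1 : (M : ℝ) ^ (2 * m) ≤ (M : ℝ) ^ (ε / 4 * k) := by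
      rw [← Real.rpow_natCast]
      refine Real.rpow_le_rpow_of_exponent_le hMle ?_
      have h2 : (m : ℝ) * Q ≤ k := by exact_mod_cast hmQ
      rw [div_lt_iff₀ hε] at hQε
      push_cast
      have h3 : (m : ℝ) * 8 ≤ m * (Q * ε) := by gcongr
      nlinarith
    calc _ ≤ 49 * (M : ℝ) ^ (ε / 4 * k) * (M : ℝ) ^ (-(β - ε / 4) * k) := by gcongr
      _ = _ := by
          rw [mul_assoc, ← Real.rpow_add hM0]
          congr 2
          ring
  -- The assumed lower bound on `t` lets the remainder be absorbed into a multiple of `t`. Dividing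
  -- by `t` then bounds `M ^ (ε k / 2)` by a constant, contradicting `hk2`.
  have hmain : t * t ≤ (49 + 2 * K) * (M : ℝ) ^ (-(β - ε / 2) * k) * t := by
    have h1 : (M : ℝ) ^ (-(2 * β) * k) ≤ (M : ℝ) ^ (-(β - ε / 2) * k) * t := by
      calc (M : ℝ) ^ (-(2 * β) * k) ≤ (M : ℝ) ^ (-(β - ε / 2) * k + -(β - ε) * k) := by
            gcongr
            nlinarith
        _ = (M : ℝ) ^ (-(β - ε / 2) * k) * (M : ℝ) ^ (-(β - ε) * k) := Real.rpow_add hM0 _ _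
        _ ≤ _ := by gcongr
    calc t * t ≤ _ := hzb
      _ ≤ 49 * (M : ℝ) ^ (-(β - ε / 2) * k) * t +
          2 * (K * ((M : ℝ) ^ (-(β - ε / 2) * k) * t)) :=
          add_le_add (mul_le_mul_of_nonneg_right hq ht0.le)
            (mul_le_mul_of_nonneg_left (hrem.trans (mul_le_mul_of_nonneg_left h1 hK0)) two_pos.le)
      _ = _ := by ring
  have hfin := ht_low.trans (le_of_mul_le_mul_right hmain ht0)
  have h4 : (M : ℝ) ^ (-(β - ε) * k) = (M : ℝ) ^ (ε / 2 * k) * (M : ℝ) ^ (-(β - ε / 2) * k) := by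
    rw [← Real.rpow_add hM0]; congr 1; ring
  rw [h4] at hfin
  exact absurd (le_of_mul_le_mul_right hfin (by positivity)) (not_le.2 hk2)

lemma limsup_spectralRadius_bakerMap_le (hM : 2 ≤ M) (hA : A.Nonempty) {χ : ℝ → ℝ}
    (hχ : IsCutoff χ) {β : ℝ} (hβ0 : 0 < β)
    (hβ : Tendsto (fun k : ℕ => -(Real.log (cantorNorm M A k) / ((k : ℝ) * Real.log (M : ℝ))))
      atTop (𝓝 β)) :
    limsup (fun k : ℕ => spectralRadius ℂ (bakerMap M A χ (M ^ k))) atTop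
      ≤ ENNReal.ofReal ((M : ℝ) ^ (-β)) := by
  have hM0 : (M : ℝ) ≠ 0 := by exact_mod_cast (by omega : M ≠ 0)
  have hlim : Tendsto (fun ε : ℝ => ENNReal.ofReal ((M : ℝ) ^ (-(β - ε)))) (𝓝[>] 0)
      (𝓝 (ENNReal.ofReal ((M : ℝ) ^ (-β)))) := by
    have : Continuous fun ε : ℝ => ENNReal.ofReal ((M : ℝ) ^ (-(β - ε))) :=
      ENNReal.continuous_ofReal.comp
        ((Real.continuous_const_rpow hM0).comp (by fun_prop))
    have h := this.tendsto 0
    rw [sub_zero] at h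
    exact h.mono_left nhdsWithin_le_nhds
  refine ge_of_tendsto hlim ?_
  filter_upwards [Ioo_mem_nhdsGT hβ0] with ε hε
  refine limsup_le_of_le (by isBoundedDefault) ?_
  filter_upwards [eventually_spectrum_bakerMap_le hM hA hχ hε.1 hε.2 hβ] with k hk
  refine iSup₂_le fun z hz => ?_
  rw [← ENNReal.ofReal_coe_nnreal, coe_nnnorm]
  exact ENNReal.ofReal_le_ofReal (hk z hz)

end Asymptotics

end OpenBaker

theorem theorem2 (M : ℕ) (A : Finset (Fin M)) (hA1 : 1 < A.card) (hAM : A.card < M) :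
    ∃ β : ℝ,
      Tendsto (fun k : ℕ => -(Real.log (OpenBaker.cantorNorm M A k) / ((k : ℝ) * Real.log (M : ℝ))))
        atTop (𝓝 β) ∧
      max 0 (1 / 2 - OpenBaker.dimension M A) < β ∧
      ∀ χ : ℝ → ℝ, OpenBaker.IsCutoff χ →
        limsup (fun k : ℕ => spectralRadius ℂ (OpenBaker.bakerMap M A χ (M ^ k))) atTop
          ≤ ENNReal.ofReal ((M : ℝ) ^ (-β)) := by
  obtain ⟨β, hβ, hmax⟩ := OpenBaker.exists_cantorNorm_exponent hA1 hAM
  exact ⟨β, hβ, hmax, fun χ hχ => OpenBaker.limsup_spectralRadius_bakerMap_le (by omega)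
    (Finset.card_pos.1 (by omega)) hχ ((le_max_left _ _).trans_lt hmax) hβ⟩
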